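/- Let $K=\mathbb{Q}(\sqrt{69})$ with ring of integers $\mathcal{O}_K$, and let $\overline{K}=K\otimes_{\mathbb Q}\mathbb{R}$, identified with $\mathbb{R}^2$ by letting $(x,y)$ stand for the element $\xi=x+y\sqrt{69}$, with conjugate $\xi'=(x,-y)$ and norm form $N(\xi)=x^2-69y^2$; $K$ is embedded in $\overline{K}$ by $x+y\sqrt{69}\mapsto(x,y)$, and $\overline K$ carries the multiplication extending that of $K$. For $\xi\in\overline{K}$ put $$M(\xi)=\inf_{\alpha\in\mathcal{O}_K}|N(\xi-\alpha)|.$$ For $S=K$ or $S=\overline{K}$ put $M_1(S)=\sup_{\xi\in S}M(\xi)$, $C_1(S)=\{\xi\in S: M(\xi)=M_1(S)\}$, $M_2(S)=\sup_{\xi\in S\setminus C_1(S)}M(\xi)$ and $C_2(S)=\{\xi\in S: M(\xi)=M_2(S)\}$. Call $M_2(S)$ isolated if there is a $\kappa<M_2(S)$ such that $M(\xi)\le\kappa$ for all $\xi\in S\setminus(C_1(S)\cup C_2(S))$. Let $\varepsilon=\frac12(25+3\sqrt{69})$ and, for integers $r\ge0$, let $$P_r=\Big(\tfrac12\varepsilon^{-r},\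 \tfrac{4}{23}+\tfrac{1}{2\sqrt{69}}\varepsilon^{-r}\Big)\in\overline{K},\qquad P_r'=\Big(\tfrac12\varepsilon^{-r},\ -\tfrac{4}{23}-\tfrac{1}{2\sqrt{69}}\varepsilon^{-r}\Big).$$ Theorem (Euclidean minima of $\mathbb{Q}(\sqrt{69})$). 1. $\varepsilon$ is the fundamental unit of $K$: it is a unit of $\mathcal{O}_K$, and every unit of $\mathcal{O}_K$ is of the form $\pm\varepsilon^n$ with $n\in\mathbb{Z}$. 2. $M_1(K)=M_1(\overline{K})=\frac{25}{23}$, and $C_1(\overline{K})$ consists exactly of the points congruent modulo $\mathcal{O}_K$ to $\frac{4}{23}\sqrt{69}$ or to $-\frac{4}{23}\sqrt{69}$; these two points are not congruent to each other. 3. $M_2(K)=M_2(\overline{K})=\frac{1}{46}\big(165-15\sqrt{69}\big)$, which is irrational. 4. $C_2(\overline{K})$ consists exactly of the points congruent modulo $\mathcal{O}_K$ to one of $P_r,-P_r,P_r',-P_r'$ with $r\ge0$. Equivalently, it consists exactly of the points congruent modulo $\mathcal{O}_K$ to $uP_0$ for some unit $u\in\mathcal{O}_K^\times$. The point $P_0=\big(\frac12,\frac{4}{23}+\frac{1}{2\sqrt{69}}\big)$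 does not lie in $K$. 5. The second minimum is not isolated: neither $M_2(K)$ nor $M_2(\overline{K})$ is isolated. -/

import Mathlib

open scoped NumberField

namespace QSqrt69

/-- There is no rational number whose square is `69`. -/
instance instFactNotSquare : Fact (∀ r : ℚ, r ^ 2 ≠ 69 + 0 * r) := by
  refine ⟨fun r hr => ?_⟩
  have h1 : IsSquare ((69 : ℕ) : ℚ) := ⟨r, by push_cast; linarith [sq r]⟩
  rw [Rat.isSquare_natCast_iff] at h1
  obtain ⟨n, hn⟩ := h1
  have h2 : n < 9 := by nlinarith
  interval_cases n <;> omega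

/-- The number field `K = ℚ(√69)`; the element `x + y√69` is `⟨x, y⟩`. -/
abbrev K : Type := QuadraticAlgebra ℚ 69 0

/-- The real algebra `K ⊗ ℝ`, identified with `ℝ²`: the point `(x, y)` is the formal expression
`x + y√69`, whose two real valuations are `|x + y√69|` and `|x - y√69|`. -/
abbrev KR : Type := QuadraticAlgebra ℝ 69 0

/-- The embedding of `K` into `K ⊗ ℝ`, `x + y√69 ↦ (x, y)`. -/
noncomputable def emb : K →+* KR where
  toFun z := ⟨(z.re : ℝ), (z.im : ℝ)⟩
  map_zero' := by ext <;> simp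
  map_one' := QuadraticAlgebra.ext (Rat.cast_one (α := ℝ)) (Rat.cast_zero (α := ℝ))
  map_add' z w := by ext <;> simp
  map_mul' z w := by ext <;> simp

/-- The image of `K` in `K ⊗ ℝ`. -/
def ratPoints : Set KR := Set.range emb

/-- The embedding of the ring of integers of `K` into `K ⊗ ℝ`. -/
noncomputable def embInt (α : 𝓞 K) : KR := emb (α : K)

/-- Congruence modulo the ring of integers of `K`. -/
def Congr (ξ η : KR) : Prop := ∃ α : 𝓞 K, ξ - η = embInt α

/-- The Euclidean minimum `M(ξ)` of a point: the infimum over the integers `α` of `K`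
of `|N(ξ - α)|`, where `N(x, y) = x² - 69 y²` is the norm form. -/
noncomputable def eMin (ξ : KR) : ℝ := ⨅ α : 𝓞 K, |QuadraticAlgebra.norm (ξ - embInt α)|

/-- The first inhomogeneous minimum of the norm form over a set `S` of points:
`S = Set.univ` gives `M₁(K ⊗ ℝ)`, and `S = ratPoints` gives `M₁(K)`. -/
noncomputable def M1 (S : Set KR) : ℝ := sSup (eMin '' S)

/-- The points of `S` at which the first minimum is attained. -/
def C1 (S : Set KR) : Set KR := {ξ ∈ S | eMin ξ = M1 S}

/-- The second inhomogeneous minimum of the norm form over a set `S` of points. -/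
noncomputable def M2 (S : Set KR) : ℝ := sSup (eMin '' (S \ C1 S))

/-- The points of `S` at which the second minimum is attained. -/
def C2 (S : Set KR) : Set KR := {ξ ∈ S | eMin ξ = M2 S}

/-- The second minimum over `S` is isolated: the minima of all points of `S` at which neither
the first nor the second minimum is attained are bounded by a constant smaller than it. -/
def M2Isolated (S : Set KR) : Prop :=
  ∃ κ < M2 S, ∀ ξ ∈ S \ (C1 S ∪ C2 S), eMin ξ ≤ κ

/-- The fundamental unit `ε = (25 + 3√69)/2`, as an element of `K`. -/
def epsK : K := ⟨25 / 2, 3 / 2⟩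

/-- The fundamental unit `ε = (25 + 3√69)/2`, as a real number. -/
noncomputable def eps : ℝ := (25 + 3 * Real.sqrt 69) / 2

/-- The point `(4/23)√69`. -/
noncomputable def Q : KR := ⟨0, 4 / 23⟩

/-- The point `P_r = ε^{-r}/2 + (4/23 + ε^{-r}/(2√69))√69`. Its conjugate is `star (P r)`. -/
noncomputable def P (r : ℕ) : KR :=
  ⟨1 / 2 * eps ^ (-(r : ℤ)), 4 / 23 + 1 / (2 * Real.sqrt 69) * eps ^ (-(r : ℤ))⟩

/-- All points congruent modulo the ring of integers to a point of the orbit of `ξ` under the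
unit group of the ring of integers. -/
def orbitMod (ξ : KR) : Set KR := {η | ∃ u : (𝓞 K)ˣ, Congr η (embInt (u : 𝓞 K) * ξ)}

end QSqrt69

namespace QSqrt69

/-! ### The ring of integers and its lattice -/

/-! Multiplication by `ε` acts on the torus `KR` modulo integers, preserves `eMin` and fixes `Q`,
because `(ε - 1) Q` is an integer. In the coordinates `pt d d'` centred at `Q` it is the hyperbolic
map `(d, d') ↦ (ε d, ε⁻¹ d')`. The point `P 0 = pt 1 0` is homoclinic to `Q`: its backward orbit
tends to `Q`, and so does its forward orbit, since `pt 1 0` is congruent to `pt 0 (-1)`.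

Upper bounds: a covering by boxes (`near_Q_or_P`) shows that, up to sign, conjugation and
translation, a point with `eMin` at least `mu` lies near `Q` or near `P 0`. Every point of its orbit
has the same minimum, so the orbit is confined as well. A nonzero displacement from `Q` grows under
`ε` or `ε⁻¹` until the orbit must enter the neighbourhood of `P 0`. There confinement gives `d ≥ 0`
and `d' ≤ 0`, and a single integer already pushes the norm below `mu` unless `d = d' = 0`
(`eq_zero_of_far_near_P`). Hence only the orbits of `Q` and `P 0` survive (`isExtremal_of_far`).

Lower bounds: at `Q` they are congruences modulo 3 and 9. At other points, a difference of small
norm can be balanced by a unit (`le_eMin_of_balanced`), so that only finitely many integers matter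
at each point of the orbit. Orbit points near `Q` inherit its larger minimum, and `P 0` itself is a
finite check.

Non-isolation: points of `K` periodic under `ε ^ n` shadow the homoclinic orbit. Their minima are
strictly below `mu` and tend to `mu`, which also gives the second minimum over `K`. -/

theorem sqrt_sq : √(69 : ℝ) * √69 = 69 := Real.mul_self_sqrt (by norm_num)

theorem sqrt_gt : (8.30662 : ℝ) < √69 := Real.lt_sqrt_of_sq_lt (by norm_num)

theorem sqrt_lt : √(69 : ℝ) < 8.30663 := (Real.sqrt_lt' (by norm_num)).2 (by norm_num)

theorem irrational_sqrt : Irrational (√69) := by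
  rw [show (69 : ℝ) = ((69 : ℕ) : ℝ) by norm_num, irrational_sqrt_natCast_iff]
  rintro ⟨n, hn⟩
  have : n < 9 := by nlinarith
  interval_cases n <;> omega

/-- The integer `m + n (1 + √69) / 2` as an element of `K`. -/
def latK (m n : ℤ) : K := ⟨m + n / 2, n / 2⟩

theorem isIntegral_latK (m n : ℤ) : IsIntegral ℤ (latK m n) := by
  obtain ⟨a, ha⟩ : ∃ a, a = 2 * m + n := ⟨_, rfl⟩
  obtain ⟨b, hb⟩ : ∃ b, b = m ^ 2 + m * n - 17 * n ^ 2 := ⟨_, rfl⟩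
  refine ⟨Polynomial.X ^ 2 - Polynomial.C a * Polynomial.X + Polynomial.C b, by monicity!, ?_⟩
  simp only [Polynomial.eval₂_add, Polynomial.eval₂_sub, Polynomial.eval₂_mul,
    Polynomial.eval₂_pow, Polynomial.eval₂_X, Polynomial.eval₂_C]
  ext
  · simp [latK, sq]; rw [ha, hb]; push_cast; ring
  · simp [latK, sq]; rw [ha]; push_cast; ring

/-- The integer `m + n (1 + √69) / 2` of `K`. -/
noncomputable def latO (m n : ℤ) : 𝓞 K := ⟨latK m n, isIntegral_latK m n⟩

theorem isIntegral_star {z : K} (hz : IsIntegral ℤ z) : IsIntegral ℤ (star z) :=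
  hz.map ((starRingEnd K).toIntAlgHom)

theorem exists_int_of_isIntegral {q : ℚ} (h : IsIntegral ℤ (⟨q, 0⟩ : K)) : ∃ n : ℤ, q = n := by
  have h' : IsIntegral ℤ (algebraMap ℚ K q) := h
  rw [isIntegral_algebraMap_iff (algebraMap ℚ K).injective] at h'
  obtain ⟨n, hn⟩ := IsIntegrallyClosed.isIntegral_iff.1 h'
  exact ⟨n, by simpa using hn.symm⟩

theorem exists_latO (α : 𝓞 K) : ∃ m n : ℤ, α = latO m n := by
  obtain ⟨z, hz⟩ := α
  have hz' : IsIntegral ℤ z := hz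
  obtain ⟨a, ha⟩ : ∃ a : ℤ, 2 * z.re = a := by
    apply exists_int_of_isIntegral
    have h : (⟨2 * z.re, 0⟩ : K) = z + star z := by ext <;> simp [two_mul]
    exact h ▸ hz'.add (isIntegral_star hz')
  obtain ⟨c, hc⟩ : ∃ c : ℤ, z.re ^ 2 - 69 * z.im ^ 2 = c := by
    apply exists_int_of_isIntegral
    have h : (⟨z.re ^ 2 - 69 * z.im ^ 2, 0⟩ : K) = z * star z := by ext <;> simp <;> ring
    exact h ▸ hz'.mul (isIntegral_star hz')
  -- Trace `a` and norm `c` give `(138 im)² = 69 (a² - 4c)`. As 69 is squarefree, it divides the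
  -- integer `138 im`, so `2 im` is an integer; the parity of `a² - 69n² = 4c` does the rest.
  have h1 : IsIntegral ℤ (138 * z.im) := by
    refine IsIntegral.of_pow (n := 2) two_pos ?_
    have : (138 * z.im) ^ 2 = ((69 * (a ^ 2 - 4 * c) : ℤ) : ℚ) := by
      push_cast
      rw [← ha, ← hc]; ring
    rw [this]
    exact isIntegral_algebraMap (R := ℤ) (A := ℚ) (x := 69 * (a ^ 2 - 4 * c))
  obtain ⟨b, hb⟩ := IsIntegrallyClosed.isIntegral_iff.1 h1
  replace hb : 138 * z.im = b := by simpa using hb.symm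
  have h2 : b ^ 2 = 69 * (a ^ 2 - 4 * c) := by
    have : (b : ℚ) ^ 2 = 69 * (a ^ 2 - 4 * c) := by rw [← ha, ← hb, ← hc]; ring
    exact_mod_cast this
  have h3 : (3 : ℤ) ∣ b := Int.prime_three.dvd_of_dvd_pow (n := 2) (by rw [h2]; omega)
  have h23 : (23 : ℤ) ∣ b :=
    Int.Prime.dvd_pow' (p := 23) (k := 2) (by norm_num) (by push_cast; rw [h2]; omega)
  obtain ⟨n, rfl⟩ : (69 : ℤ) ∣ b := by omega
  have h4 : 69 * n ^ 2 = a ^ 2 - 4 * c := by linarith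
  have h5 : (2 : ℤ) ∣ a - n := by
    have : Even (a ^ 2 - 69 * n ^ 2) := ⟨2 * c, by linarith⟩
    simp only [Int.even_sub, Int.even_mul, Int.even_pow' two_ne_zero] at this
    have h : Even (a - n) := by
      rw [Int.even_sub]
      have : ¬ Even (69 : ℤ) := by decide
      tauto
    exact h.two_dvd
  obtain ⟨m, hm⟩ := h5
  refine ⟨m, n, Subtype.ext (QuadraticAlgebra.ext ?_ ?_)⟩
  · change z.re = m + n / 2
    have : (a : ℚ) - n = 2 * m := by exact_mod_cast hm
    linarith
  · change z.im = n / 2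
    push_cast at hb
    linarith

/-- The integer `m + n (1 + √69) / 2` as a point of `KR`. -/
noncomputable def lat (m n : ℤ) : KR := ⟨m + n / 2, n / 2⟩

theorem embInt_latO (m n : ℤ) : embInt (latO m n) = lat m n := by
  change emb (latK m n) = _
  ext <;> simp [emb, latK, lat]

theorem exists_lat (α : 𝓞 K) : ∃ m n : ℤ, embInt α = lat m n := by
  obtain ⟨m, n, rfl⟩ := exists_latO α
  exact ⟨m, n, embInt_latO m n⟩

theorem congr_iff {ξ η : KR} : Congr ξ η ↔ ∃ m n : ℤ, ξ - η = lat m n := by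
  constructor
  · rintro ⟨α, h⟩
    obtain ⟨m, n, h'⟩ := exists_lat α
    exact ⟨m, n, h.trans h'⟩
  · rintro ⟨m, n, h⟩
    exact ⟨latO m n, h.trans (embInt_latO m n).symm⟩

theorem embInt_add (α β : 𝓞 K) : embInt (α + β) = embInt α + embInt β := by
  simp [embInt]

theorem embInt_mul (α β : 𝓞 K) : embInt (α * β) = embInt α * embInt β := by
  simp [embInt]

theorem embInt_neg (α : 𝓞 K) : embInt (-α) = -embInt α := by
  simp [embInt]

theorem embInt_one : embInt 1 = 1 := by
  simp [embInt]

theorem Congr.refl (ξ : KR) : Congr ξ ξ := ⟨0, by simp [embInt]⟩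

theorem Congr.symm {ξ η : KR} (h : Congr ξ η) : Congr η ξ := by
  obtain ⟨α, h⟩ := h
  exact ⟨-α, by rw [embInt_neg, ← h]; ring⟩

theorem Congr.trans {ξ η ζ : KR} (h : Congr ξ η) (h' : Congr η ζ) : Congr ξ ζ := by
  obtain ⟨α, h⟩ := h
  obtain ⟨β, h'⟩ := h'
  exact ⟨α + β, by rw [embInt_add, ← h, ← h']; ring⟩

theorem Congr.mul {ξ η : KR} (h : Congr ξ η) (β : 𝓞 K) :
    Congr (embInt β * ξ) (embInt β * η) := by
  obtain ⟨α, h⟩ := h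
  exact ⟨β * α, by rw [embInt_mul, ← h]; ring⟩

theorem Congr.neg {ξ η : KR} (h : Congr ξ η) : Congr (-ξ) (-η) := by
  obtain ⟨α, h⟩ := h
  exact ⟨-α, by rw [embInt_neg, ← h]; ring⟩

theorem star_lat (m n : ℤ) : star (lat m n) = lat (m + n) (-n) := by
  ext <;> simp [lat] <;> ring

theorem Congr.star {ξ η : KR} (h : Congr ξ η) : Congr (star ξ) (star η) := by
  obtain ⟨m, n, h⟩ := congr_iff.1 h
  exact congr_iff.2 ⟨m + n, -n, by rw [← star_sub, h, star_lat]⟩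

/-! ### Valuations and the norm -/

/-- The valuation `x + y√69`. -/
noncomputable def phi : KR →+* ℝ where
  toFun z := z.re + √69 * z.im
  map_zero' := by simp
  map_one' := by
    rw [show (1 : KR).re = 1 from rfl, show (1 : KR).im = 0 from rfl]; simp
  map_add' z w := by simp; ring
  map_mul' z w := by simp; linear_combination (-(z.im * w.im)) * sqrt_sq

/-- The valuation `x - y√69`. -/
noncomputable def psi : KR →+* ℝ where
  toFun z := z.re - √69 * z.im
  map_zero' := by simp
  map_one' := by
    rw [show (1 : KR).re = 1 from rfl, show (1 : KR).im = 0 from rfl]; simp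
  map_add' z w := by simp; ring
  map_mul' z w := by simp; linear_combination (-(z.im * w.im)) * sqrt_sq

theorem phi_apply (z : KR) : phi z = z.re + √69 * z.im := rfl

theorem psi_apply (z : KR) : psi z = z.re - √69 * z.im := rfl

theorem norm_eq (z : KR) : QuadraticAlgebra.norm z = phi z * psi z := by
  rw [QuadraticAlgebra.norm_def, phi_apply, psi_apply]
  linear_combination (z.im * z.im) * sqrt_sq

theorem ext_phi_psi {z w : KR} (h : phi z = phi w) (h' : psi z = psi w) : z = w := by
  rw [phi_apply, phi_apply] at h
  rw [psi_apply, psi_apply] at h'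
  have := sqrt_gt
  ext
  · linarith
  · have : √69 * (z.im - w.im) = 0 := by linarith
    rcases mul_eq_zero.1 this with h | h <;> linarith

theorem phi_lat (m n : ℤ) : phi (lat m n) = m + n * ((1 + √69) / 2) := by
  rw [phi_apply, lat]; ring

theorem psi_lat (m n : ℤ) : psi (lat m n) = m + n * ((1 - √69) / 2) := by
  rw [psi_apply, lat]; ring

/-- The value of `|N(ξ - α)|` for `α = m + n (1 + √69) / 2`. -/
noncomputable def dist (ξ : KR) (m n : ℤ) : ℝ := |phi (ξ - lat m n) * psi (ξ - lat m n)|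

theorem bddBelow_range (ξ : KR) :
    BddBelow (Set.range fun α : 𝓞 K => |QuadraticAlgebra.norm (ξ - embInt α)|) :=
  ⟨0, by rintro _ ⟨α, rfl⟩; exact abs_nonneg _⟩

theorem eMin_le (ξ : KR) (m n : ℤ) : eMin ξ ≤ dist ξ m n := by
  have := ciInf_le (bddBelow_range ξ) (latO m n)
  rwa [embInt_latO, norm_eq] at this

theorem le_eMin {ξ : KR} {c : ℝ} (h : ∀ m n, c ≤ dist ξ m n) : c ≤ eMin ξ := by
  refine le_ciInf fun α => ?_
  obtain ⟨m, n, hα⟩ := exists_lat α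
  rw [hα, norm_eq]
  exact h m n

theorem eMin_of_congr {ξ η : KR} (h : Congr ξ η) : eMin ξ = eMin η := by
  obtain ⟨β, h⟩ := h
  refine (Equiv.iInf_congr (Equiv.addRight β) fun α => ?_).symm
  rw [Equiv.coe_addRight, embInt_add, ← h]
  congr 2
  ring

theorem eMin_neg (ξ : KR) : eMin (-ξ) = eMin ξ := by
  refine Equiv.iInf_congr (Equiv.neg _) fun α => ?_
  rw [Equiv.neg_apply, embInt_neg, ← QuadraticAlgebra.norm_neg]
  congr 2
  ring

theorem eMin_star (ξ : KR) : eMin (star ξ) = eMin ξ := by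
  refine le_antisymm (le_eMin fun m n => ?_) (le_eMin fun m n => ?_)
  · refine (eMin_le _ (m + n) (-n)).trans_eq ?_
    rw [dist, dist, ← norm_eq, ← norm_eq, ← star_lat, ← star_sub, QuadraticAlgebra.norm_star]
  · refine (eMin_le _ (m + n) (-n)).trans_eq ?_
    rw [dist, dist, ← norm_eq, ← norm_eq, ← star_lat, ← QuadraticAlgebra.norm_star, star_sub,
      star_star]

theorem norm_embInt_unit (u : (𝓞 K)ˣ) : |QuadraticAlgebra.norm (embInt (u : 𝓞 K))| = 1 := by
  have key (α : 𝓞 K) : ∃ c : ℤ, QuadraticAlgebra.norm (embInt α) = c := by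
    obtain ⟨m, n, h⟩ := exists_lat α
    refine ⟨m ^ 2 + m * n - 17 * n ^ 2, ?_⟩
    rw [h, QuadraticAlgebra.norm_def, lat]
    push_cast
    ring
  obtain ⟨a, ha⟩ := key u
  obtain ⟨b, hb⟩ := key (u⁻¹ : (𝓞 K)ˣ)
  have h : (a : ℝ) * b = 1 := by
    rw [← ha, ← hb, ← map_mul, ← embInt_mul, ← Units.val_mul, mul_inv_cancel, Units.val_one,
      embInt_one, map_one]
  have h' : IsUnit a := .of_mul_eq_one b (by exact_mod_cast h)
  rw [ha]
  exact_mod_cast Int.isUnit_iff_abs_eq.1 h'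

theorem eMin_unit_mul (u : (𝓞 K)ˣ) (ξ : KR) : eMin (embInt (u : 𝓞 K) * ξ) = eMin ξ := by
  refine (Equiv.iInf_congr u.mulLeft fun α => ?_).symm
  rw [Units.mulLeft_apply, embInt_mul, ← mul_sub, map_mul, abs_mul, norm_embInt_unit, one_mul]

/-! ### The fundamental unit -/

/-- The fundamental unit as a unit of the ring of integers. -/
noncomputable def unitE : (𝓞 K)ˣ where
  val := latO 11 3
  inv := latO 14 (-3)
  val_inv := Subtype.ext (by
    change latK 11 3 * latK 14 (-3) = 1
    refine QuadraticAlgebra.ext ?_ ?_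
    · rw [show (1 : K).re = 1 from rfl]; simp [latK]; norm_num
    · rw [show (1 : K).im = 0 from rfl]; simp [latK]; norm_num)
  inv_val := Subtype.ext (by
    change latK 14 (-3) * latK 11 3 = 1
    refine QuadraticAlgebra.ext ?_ ?_
    · rw [show (1 : K).re = 1 from rfl]; simp [latK]; norm_num
    · rw [show (1 : K).im = 0 from rfl]; simp [latK]; norm_num)

theorem unitE_coe : ((unitE : 𝓞 K) : K) = epsK := by
  change latK 11 3 = epsK
  rw [latK, epsK]
  norm_num

theorem eps_gt : (24.9599 : ℝ) < eps := by
  have := sqrt_gt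
  rw [eps]; linarith

theorem eps_lt : eps < (24.96 : ℝ) := by
  have := sqrt_lt
  rw [eps]; linarith

theorem eps_pos : 0 < eps := by linarith [eps_gt]

theorem one_lt_eps : 1 < eps := by linarith [eps_gt]

theorem inv_eps : eps⁻¹ = (25 - 3 * √69) / 2 := by
  refine inv_eq_of_mul_eq_one_right ?_
  rw [eps]
  linear_combination (-9 / 4) * sqrt_sq

theorem inv_eps_lt : eps⁻¹ < (0.04008 : ℝ) := by
  have := sqrt_gt
  rw [inv_eps]; linarith

theorem inv_eps_pos : 0 < eps⁻¹ := inv_pos.2 eps_pos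

/-- The embedding `embInt` as a ring homomorphism. -/
noncomputable def embHom : 𝓞 K →+* KR := emb.comp (algebraMap (𝓞 K) K)

theorem phi_unitE_zpow (n : ℤ) : phi (embInt (unitE ^ n : (𝓞 K)ˣ)) = eps ^ n := by
  have h1 : phi (embInt (unitE : 𝓞 K)) = eps := by
    change phi (embInt (latO 11 3)) = eps
    rw [embInt_latO, phi_lat, eps]; push_cast; ring
  have := congrArg Units.val (map_zpow (Units.map (phi.comp embHom).toMonoidHom) unitE n)
  rw [Units.val_zpow_eq_zpow_val] at this
  change phi (embInt _) = phi (embInt (unitE : 𝓞 K)) ^ n at this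
  rw [this, h1]

theorem psi_unitE_zpow (n : ℤ) : psi (embInt (unitE ^ n : (𝓞 K)ˣ)) = eps⁻¹ ^ n := by
  have h1 : psi (embInt (unitE : 𝓞 K)) = eps⁻¹ := by
    change psi (embInt (latO 11 3)) = eps⁻¹
    rw [embInt_latO, psi_lat, inv_eps]; push_cast; ring
  have := congrArg Units.val (map_zpow (Units.map (psi.comp embHom).toMonoidHom) unitE n)
  rw [Units.val_zpow_eq_zpow_val] at this
  change psi (embInt _) = psi (embInt (unitE : 𝓞 K)) ^ n at this
  rw [this, h1]

theorem eq_one_of_phi_mem (v : (𝓞 K)ˣ) (h1 : 1 ≤ phi (embInt v)) (h2 : phi (embInt v) < eps) :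
    v = 1 := by
  obtain ⟨m, n, hmn⟩ := exists_latO (v : 𝓞 K)
  have hN := norm_embInt_unit v
  rw [hmn, embInt_latO] at h1 h2 hN
  have hN' : m ^ 2 + m * n - 17 * n ^ 2 = 1 := by
    rw [QuadraticAlgebra.norm_def, lat] at hN
    have h : |m ^ 2 + m * n - 17 * n ^ 2| = 1 := by
      rify
      rw [← hN]
      congr 1
      ring
    rcases (abs_eq zero_le_one).1 h with h | h
    · exact h
    · exfalso
      obtain ⟨c, rfl | rfl | rfl⟩ : ∃ c, n = m + 3 * c ∨ n = m + 3 * c + 1 ∨ n = m + 3 * c + 2 :=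
        ⟨(n - m) / 3, by omega⟩ <;> ring_nf at h <;> omega
  have hpq : phi (lat m n) * psi (lat m n) = 1 := by
    rw [phi_lat, psi_lat]
    have : (m : ℝ) ^ 2 + m * n - 17 * n ^ 2 = 1 := by exact_mod_cast hN'
    linear_combination this - (n ^ 2 / 4 : ℝ) * sqrt_sq
  have hpos : 0 < phi (lat m n) := by linarith
  have hq : psi (lat m n) = (phi (lat m n))⁻¹ := eq_inv_of_mul_eq_one_right hpq
  have hq1 : psi (lat m n) ≤ 1 := by rw [hq]; exact inv_le_one_of_one_le₀ h1
  have hq2 : eps⁻¹ < psi (lat m n) := by rw [hq]; exact inv_strictAnti₀ hpos h2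
  rw [inv_eps] at hq2
  rw [eps] at h2
  rw [psi_lat] at hq1 hq2
  rw [phi_lat] at h1 h2
  have hs := sqrt_gt
  have hn0 : 0 ≤ n := by
    by_contra hn
    have : (n : ℝ) ≤ -1 := by exact_mod_cast (by omega : n ≤ -1)
    nlinarith
  have hn3 : n < 3 := by
    by_contra hn
    have : (3 : ℝ) ≤ n := by exact_mod_cast (by omega : 3 ≤ n)
    nlinarith
  have key : n = 0 ∧ m = 1 := by
    interval_cases n
    · have : (0 : ℝ) < m := by push_cast at h1; linarith
      have : 0 < m := by exact_mod_cast this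
      exact ⟨rfl, by nlinarith⟩
    · exfalso
      have h3 : m < 5 := by nlinarith
      have h4 : -6 < m := by nlinarith
      interval_cases m <;> omega
    · exfalso
      have h3 : m < 9 := by nlinarith
      have h4 : -11 < m := by nlinarith
      interval_cases m <;> omega
  refine Units.ext (Subtype.ext ?_)
  rw [hmn, key.1, key.2]
  change latK 1 0 = 1
  refine QuadraticAlgebra.ext ?_ ?_
  · rw [show (1 : K).re = 1 from rfl]; simp [latK]
  · rw [show (1 : K).im = 0 from rfl]; simp [latK]

theorem exists_zpow_unitE (u : (𝓞 K)ˣ) : ∃ n : ℤ, u = unitE ^ n ∨ u = -unitE ^ n := by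
  have h0 : phi (embInt (u : 𝓞 K)) ≠ 0 := by
    intro h
    have := norm_embInt_unit u
    rw [norm_eq, h] at this
    simp at this
  obtain ⟨n, hn1, hn2⟩ := exists_mem_Ico_zpow (abs_pos.2 h0) one_lt_eps
  have hpos : 0 < eps ^ n := zpow_pos eps_pos n
  have key (w : (𝓞 K)ˣ) (hw : phi (embInt (w : 𝓞 K)) = |phi (embInt (u : 𝓞 K))|) :
      w = unitE ^ n := by
    have hv : phi (embInt ((w * unitE ^ (-n) : (𝓞 K)ˣ) : 𝓞 K)) =
        |phi (embInt (u : 𝓞 K))| / eps ^ n := by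
      rw [Units.val_mul, embInt_mul, map_mul, hw, phi_unitE_zpow, zpow_neg, div_eq_mul_inv]
    have := eq_one_of_phi_mem (w * unitE ^ (-n)) (by rw [hv, le_div_iff₀ hpos]; linarith)
      (by rw [hv, div_lt_iff₀ hpos, mul_comm, ← zpow_add_one₀ eps_pos.ne']; exact hn2)
    rwa [zpow_neg, mul_inv_eq_one] at this
  refine ⟨n, ?_⟩
  rcases le_total 0 (phi (embInt (u : 𝓞 K))) with h | h
  · exact .inl (key u (abs_of_nonneg h).symm)
  · refine .inr ?_
    rw [← key (-u) (by rw [Units.val_neg, embInt_neg, map_neg, abs_of_nonpos h]), neg_neg]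

/-! ### Orbits under the unit group -/

theorem mem_orbitMod_self (ξ : KR) : ξ ∈ orbitMod ξ :=
  ⟨1, by rw [Units.val_one, embInt_one, one_mul]; exact Congr.refl ξ⟩

theorem orbitMod_trans {ξ η ζ : KR} (h : ξ ∈ orbitMod η) (h' : η ∈ orbitMod ζ) :
    ξ ∈ orbitMod ζ := by
  obtain ⟨u, h⟩ := h
  obtain ⟨v, h'⟩ := h'
  refine ⟨u * v, h.trans ?_⟩
  rw [Units.val_mul, embInt_mul, mul_assoc]
  exact h'.mul u

theorem orbitMod_symm {ξ η : KR} (h : ξ ∈ orbitMod η) : η ∈ orbitMod ξ := by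
  obtain ⟨u, h⟩ := h
  refine ⟨u⁻¹, ?_⟩
  have := (h.mul (u⁻¹ : (𝓞 K)ˣ)).symm
  rwa [← mul_assoc, ← embInt_mul, ← Units.val_mul, inv_mul_cancel, Units.val_one, embInt_one,
    one_mul] at this

theorem orbitMod_of_congr {ξ η : KR} (h : Congr ξ η) : ξ ∈ orbitMod η :=
  ⟨1, by rwa [Units.val_one, embInt_one, one_mul]⟩

theorem neg_mem_orbitMod (ξ : KR) : -ξ ∈ orbitMod ξ :=
  ⟨-1, by rw [Units.val_neg, Units.val_one, embInt_neg, embInt_one, neg_one_mul]; exact .refl _⟩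

theorem eMin_of_orbitMod {ξ η : KR} (h : ξ ∈ orbitMod η) : eMin ξ = eMin η := by
  obtain ⟨u, h⟩ := h
  rw [eMin_of_congr h, eMin_unit_mul]

theorem phi_star (z : KR) : phi (star z) = psi z := by
  simp [phi_apply, psi_apply, sub_eq_add_neg]

theorem psi_star (z : KR) : psi (star z) = phi z := by
  simp [phi_apply, psi_apply]

/-- The conjugate of a unit must again be a unit; this is read off the classification, since `ε` has
norm 1 and so `ε ^ n` has conjugate `ε ^ (-n)`. -/
theorem star_mem_orbitMod {ξ η : KR} (h : ξ ∈ orbitMod η) : star ξ ∈ orbitMod (star η) := by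
  obtain ⟨u, h⟩ := h
  obtain ⟨v, hv⟩ : ∃ v : (𝓞 K)ˣ, star (embInt (u : 𝓞 K)) = embInt (v : 𝓞 K) := by
    obtain ⟨n, rfl | rfl⟩ := exists_zpow_unitE u
    · refine ⟨unitE ^ (-n), ext_phi_psi ?_ ?_⟩
      · rw [phi_star, phi_unitE_zpow, psi_unitE_zpow, inv_zpow']
      · rw [psi_star, phi_unitE_zpow, psi_unitE_zpow, inv_zpow', neg_neg]
    · refine ⟨-unitE ^ (-n), ext_phi_psi ?_ ?_⟩
      · rw [phi_star, Units.val_neg, embInt_neg, Units.val_neg, embInt_neg, map_neg, map_neg,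
          phi_unitE_zpow, psi_unitE_zpow, inv_zpow']
      · rw [psi_star, Units.val_neg, embInt_neg, Units.val_neg, embInt_neg, map_neg, map_neg,
          phi_unitE_zpow, psi_unitE_zpow, inv_zpow', neg_neg]
  refine ⟨v, ?_⟩
  rw [← hv, mul_comm, ← star_mul]
  exact h.star

/-! ### Points near `Q` -/

/-- The point `Q` displaced by `d` and `d'` in the two valuations. -/
noncomputable def pt (d d' : ℝ) : KR := ⟨(d + d') / 2, 4 / 23 + (d - d') / (2 * √69)⟩

theorem sqrt_ne_zero : √(69 : ℝ) ≠ 0 := by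
  have := sqrt_gt
  linarith

theorem phi_pt (d d' : ℝ) : phi (pt d d') = 4 / 23 * √69 + d := by
  have := sqrt_ne_zero
  rw [phi_apply, pt]
  field_simp
  ring

theorem psi_pt (d d' : ℝ) : psi (pt d d') = -(4 / 23 * √69) + d' := by
  have := sqrt_ne_zero
  rw [psi_apply, pt]
  field_simp
  ring

theorem pt_zero : pt 0 0 = Q := by
  rw [pt, Q]; norm_num

theorem pt_one : pt 1 0 = P 0 := by
  rw [pt, P]; norm_num

/-- `ε Q - Q = 18 + 2√69` is an integer, so `Q` is a fixed point and `ε` acts diagonally on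
displacements from it. -/
theorem pt_unitE_mul (d d' : ℝ) :
    Congr (embInt (unitE : 𝓞 K) * pt d d') (pt (eps * d) (eps⁻¹ * d')) := by
  have h1 := phi_unitE_zpow 1
  have h2 := psi_unitE_zpow 1
  rw [zpow_one, zpow_one] at h1 h2
  refine congr_iff.2 ⟨16, 4, ext_phi_psi ?_ ?_⟩
  · rw [map_sub, map_mul, phi_pt, phi_pt, phi_lat, h1, eps]
    push_cast
    linear_combination (6 / 23) * sqrt_sq
  · rw [map_sub, map_mul, psi_pt, psi_pt, psi_lat, h2, inv_eps]
    push_cast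
    linear_combination (6 / 23) * sqrt_sq

theorem pt_zpow_mul (n : ℤ) (d d' : ℝ) :
    Congr (embInt (unitE ^ n : (𝓞 K)ˣ) * pt d d') (pt (eps ^ n * d) (eps⁻¹ ^ n * d')) := by
  have he := eps_pos.ne'
  induction n with
  | zero => simpa [embInt_one] using Congr.refl _
  | succ n ih =>
    have h1 := (ih.mul unitE).trans (pt_unitE_mul _ _)
    rw [← mul_assoc, ← embInt_mul, ← Units.val_mul, ← mul_assoc, ← mul_assoc] at h1
    rwa [zpow_add_one₀ he, zpow_add_one₀ (inv_ne_zero he), zpow_add_one, mul_comm (_ ^ _) unitE,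
      mul_comm (_ ^ _) eps, mul_comm (_ ^ _) eps⁻¹]
  | pred n ih =>
    have h1 := (pt_unitE_mul (eps⁻¹ * (eps ^ (-n : ℤ) * d)) (eps * (eps⁻¹ ^ (-n : ℤ) * d'))).symm
    rw [mul_inv_cancel_left₀ he, inv_mul_cancel_left₀ he] at h1
    have h2 := (ih.trans h1).mul (unitE⁻¹ : (𝓞 K)ˣ)
    rw [← mul_assoc, ← embInt_mul, ← Units.val_mul, ← mul_assoc (embInt _), ← embInt_mul,
      ← Units.val_mul, inv_mul_cancel, Units.val_one, embInt_one, one_mul] at h2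
    rwa [zpow_sub_one₀ he, zpow_sub_one₀ (inv_ne_zero he), zpow_sub_one, mul_comm (_ ^ _) unitE⁻¹,
      mul_comm (_ ^ _) eps⁻¹, mul_comm (_ ^ _) eps⁻¹⁻¹, inv_inv, mul_assoc, mul_assoc]

theorem pt_zpow_mem_orbitMod (n : ℤ) (d d' : ℝ) :
    pt (eps ^ n * d) (eps⁻¹ ^ n * d') ∈ orbitMod (pt d d') :=
  ⟨unitE ^ n, (pt_zpow_mul n d d').symm⟩

/-- Translation by 1 trades a displacement near 1 in the expanding direction for one near `-1` in
the contracting direction; this makes `P 0` homoclinic to `Q`. -/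
theorem congr_pt_sub_one (d d' : ℝ) : Congr (pt (1 + d) d') (pt d (d' - 1)) := by
  refine congr_iff.2 ⟨1, 0, ext_phi_psi ?_ ?_⟩
  · rw [map_sub, phi_pt, phi_pt, phi_lat]; push_cast; ring
  · rw [map_sub, psi_pt, psi_pt, psi_lat]; push_cast; ring

theorem star_pt (d d' : ℝ) : star (pt d d') = -pt (-d') (-d) := by
  refine ext_phi_psi ?_ ?_
  · rw [phi_star, map_neg, psi_pt, phi_pt]; ring
  · rw [psi_star, map_neg, psi_pt, phi_pt]; ring

theorem dist_pt (d d' : ℝ) (m n : ℤ) :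
    dist (pt d d') m n = |(4 / 23 * √69 + d - (m + n * ((1 + √69) / 2))) *
      (-(4 / 23 * √69) + d' - (m + n * ((1 - √69) / 2)))| := by
  rw [dist, map_sub, map_sub, phi_pt, psi_pt, phi_lat, psi_lat]

/-! ### Covering a fundamental domain -/

theorem sq_le_of_mem_Icc {u u0 u1 : ℝ} (h0 : u0 ≤ u) (h1 : u ≤ u1) :
    u ^ 2 ≤ max (u0 ^ 2) (u1 ^ 2) := by
  rcases le_total 0 u with h | h
  · exact le_max_of_le_right (by nlinarith)
  · exact le_max_of_le_left (by nlinarith)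

theorem le_sq_of_mem_Icc {u u0 u1 : ℝ} (h0 : u0 ≤ u) (h1 : u ≤ u1) :
    max (max u0 (-u1)) 0 ^ 2 ≤ u ^ 2 := by
  rw [← sq_abs u]
  refine pow_le_pow_left₀ (le_max_right _ _) (max_le (max_le ?_ ?_) (abs_nonneg u)) 2
  · exact h0.trans (le_abs_self u)
  · exact (neg_le_neg h1).trans (neg_le_abs u)

/-- Interval arithmetic: each square is bounded above and below by its extremes on the box, so two
rational inequalities show that one integer serves the whole box. -/
theorem not_lt_of_box {x y x0 x1 y0 y1 : ℝ}
    (h : ∀ m n : ℤ, 0.878 < |(x - (m + n / 2)) ^ 2 - 69 * (y - n / 2) ^ 2|) (m n : ℤ)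
    (hx0 : x0 ≤ x) (hx1 : x ≤ x1) (hy0 : y0 ≤ y) (hy1 : y ≤ y1)
    (h1 : max ((x0 - (m + n / 2)) ^ 2) ((x1 - (m + n / 2)) ^ 2) -
      69 * max (max (y0 - n / 2) (-(y1 - n / 2))) 0 ^ 2 ≤ 0.878)
    (h2 : 69 * max ((y0 - n / 2) ^ 2) ((y1 - n / 2) ^ 2) -
      max (max (x0 - (m + n / 2)) (-(x1 - (m + n / 2)))) 0 ^ 2 ≤ 0.878) : False := by
  refine (h m n).not_ge (abs_le.2 ⟨?_, ?_⟩)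
  · linarith [le_sq_of_mem_Icc (sub_le_sub_right hx0 (m + n / 2 : ℝ))
        (sub_le_sub_right hx1 (m + n / 2 : ℝ)),
      sq_le_of_mem_Icc (sub_le_sub_right hy0 (n / 2 : ℝ)) (sub_le_sub_right hy1 (n / 2 : ℝ))]
  · linarith [sq_le_of_mem_Icc (sub_le_sub_right hx0 (m + n / 2 : ℝ))
        (sub_le_sub_right hx1 (m + n / 2 : ℝ)),
      le_sq_of_mem_Icc (sub_le_sub_right hy0 (n / 2 : ℝ)) (sub_le_sub_right hy1 (n / 2 : ℝ))]

theorem near_of_box {x y x0 x1 y0 y1 a b c : ℝ} (hx0 : x0 ≤ x) (hx1 : x ≤ x1) (hy0 : y0 ≤ y)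
    (hy1 : y ≤ y1)
    (h : max (x1 - a) (-(x0 - a)) + 8.307 * max (y1 - b) (-(y0 - b)) ≤ c) :
    |x - a| + 8.307 * |y - b| ≤ c := by
  have h1 : |x - a| ≤ max (x1 - a) (-(x0 - a)) := max_le_max (by linarith) (by linarith)
  have h2 : |y - b| ≤ max (y1 - b) (-(y0 - b)) := max_le_max (by linarith) (by linarith)
  linarith

/-- In a quarter of a fundamental domain, only points near `Q` or `P 0` can have a large
Euclidean minimum. -/
theorem near_Q_or_P {x y : ℝ}
    (h : ∀ m n : ℤ, 0.878 < |(x - (m + n / 2)) ^ 2 - 69 * (y - n / 2) ^ 2|)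
    (hx0 : 0 ≤ x) (hx1 : x ≤ 1 / 2) (hy0 : 0 ≤ y) (hy1 : y ≤ 1 / 4) :
    |x - 0| + 8.307 * |y - 4 / 23| ≤ 0.0999 ∨ |x - 1 / 2| + 8.307 * |y - 0.2341| ≤ 0.0989 := by
  -- A bisection tree: each leaf names an integer that serves its box, except for the two boxes
  -- around `Q` and `P 0`. The constant 0.878 is just below `mu`, 8.307 just above `√69`, and 0.2341
  -- approximates the second coordinate of `P 0`.
  rcases le_total y (17 / 400) with h1 | h1
  · exact (not_lt_of_box h 0 0 hx0 hx1 hy0 h1 (by norm_num [max_def])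
      (by norm_num [max_def])).elim
  · rcases le_total y (49 / 400) with h2 | h2
    · exact (not_lt_of_box h 1 0 hx0 hx1 h1 h2 (by norm_num [max_def])
        (by norm_num [max_def])).elim
    · rcases le_total y (61 / 400) with h3 | h3
      · rcases le_total x (37 / 100) with h4 | h4
        · exact (not_lt_of_box h (-1) 0 hx0 h4 h2 h3 (by norm_num [max_def])
            (by norm_num [max_def])).elim
        · rcases le_total y (11 / 80) with h5 | h5
          · exact (not_lt_of_box h 3 1 h4 hx1 h2 h5 (by norm_num [max_def])
              (by norm_num [max_def])).elim
          · exact (not_lt_of_box h (-3) 1 h4 hx1 h5 h3 (by norm_num [max_def])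
              (by norm_num [max_def])).elim
      · rcases le_total y (67 / 400) with h6 | h6
        · rcases le_total x (3 / 100) with h7 | h7
          · exact (not_lt_of_box h 6 (-1) hx0 h7 h3 h6 (by norm_num [max_def])
              (by norm_num [max_def])).elim
          · exact (not_lt_of_box h (-1) 0 h7 hx1 h3 h6 (by norm_num [max_def])
              (by norm_num [max_def])).elim
        · rcases le_total x (197 / 500) with h8 | h8
          · rcases le_total y (3 / 16) with h9 | h9
            · rcases le_total x (1 / 25) with h10 | h10
              · rcases le_total y (9 / 50) with h11 | h11
                · exact .inl (near_of_box hx0 h10 h6 h11 (by norm_num [max_def]))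
                · exact (not_lt_of_box h (-3) 1 hx0 h10 h11 h9 (by norm_num [max_def])
                    (by norm_num [max_def])).elim
              · rcases le_total x (1 / 10) with h12 | h12
                · rcases le_total y (7 / 40) with h13 | h13
                  · exact (not_lt_of_box h (-5) (-1) h10 h12 h6 h13 (by norm_num [max_def])
                      (by norm_num [max_def])).elim
                  · exact (not_lt_of_box h (-3) 1 h10 h12 h13 h9 (by norm_num [max_def])
                      (by norm_num [max_def])).elim
                · rcases le_total x (1 / 4) with h14 | h14
                  · exact (not_lt_of_box h (-3) 1 h12 h14 h6 h9 (by norm_num [max_def])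
                      (by norm_num [max_def])).elim
                  · exact (not_lt_of_box h (-1) 0 h14 h8 h6 h9 (by norm_num [max_def])
                      (by norm_num [max_def])).elim
            · rcases le_total y (49 / 200) with h15 | h15
              · rcases le_total x (19 / 100) with h16 | h16
                · rcases le_total y (39 / 200) with h17 | h17
                  · exact (not_lt_of_box h (-3) 1 hx0 h16 h9 h17 (by norm_num [max_def])
                      (by norm_num [max_def])).elim
                  · rcases le_total x (13 / 100) with h18 | h18
                    · rcases le_total y (43 / 200) with h19 | h19
                      · exact (not_lt_of_box h 2 1 hx0 h18 h17 h19 (by norm_num [max_def])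
                          (by norm_num [max_def])).elim
                      · exact (not_lt_of_box h 2 0 hx0 h18 h19 h15 (by norm_num [max_def])
                          (by norm_num [max_def])).elim
                    · exact (not_lt_of_box h 2 0 h18 h16 h17 h15 (by norm_num [max_def])
                        (by norm_num [max_def])).elim
                · rcases le_total y (223 / 1000) with h20 | h20
                  · exact (not_lt_of_box h 2 0 h16 h8 h9 h20 (by norm_num [max_def])
                      (by norm_num [max_def])).elim
                  · exact (not_lt_of_box h 2 1 h16 h8 h20 h15 (by norm_num [max_def])
                      (by norm_num [max_def])).elim
              · rcases le_total x (23 / 100) with h21 | h21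
                · exact (not_lt_of_box h (-2) 0 hx0 h21 h15 hy1 (by norm_num [max_def])
                    (by norm_num [max_def])).elim
                · exact (not_lt_of_box h 2 1 h21 h8 h15 hy1 (by norm_num [max_def])
                    (by norm_num [max_def])).elim
          · rcases le_total y (21 / 100) with h22 | h22
            · exact (not_lt_of_box h 2 0 h8 hx1 h6 h22 (by norm_num [max_def])
                (by norm_num [max_def])).elim
            · rcases le_total x (23 / 50) with h23 | h23
              · rcases le_total y (221 / 1000) with h24 | h24
                · rcases le_total x (209 / 500) with h25 | h25
                  · exact (not_lt_of_box h 2 0 h8 h25 h22 h24 (by norm_num [max_def])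
                      (by norm_num [max_def])).elim
                  · exact (not_lt_of_box h (-5) (-1) h25 h23 h22 h24 (by norm_num [max_def])
                      (by norm_num [max_def])).elim
                · rcases le_total y (89 / 400) with h26 | h26
                  · rcases le_total x (203 / 500) with h27 | h27
                    · exact (not_lt_of_box h 2 0 h8 h27 h24 h26 (by norm_num [max_def])
                        (by norm_num [max_def])).elim
                    · exact (not_lt_of_box h (-7) 2 h27 h23 h24 h26 (by norm_num [max_def])
                        (by norm_num [max_def])).elim
                  · rcases le_total y (23 / 100) with h28 | h28
                    · exact (not_lt_of_box h (-7) 2 h8 h23 h26 h28 (by norm_num [max_def])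
                        (by norm_num [max_def])).elim
                    · exact (not_lt_of_box h 2 1 h8 h23 h28 hy1 (by norm_num [max_def])
                        (by norm_num [max_def])).elim
              · rcases le_total y (219 / 1000) with h29 | h29
                · exact (not_lt_of_box h 6 2 h23 hx1 h22 h29 (by norm_num [max_def])
                    (by norm_num [max_def])).elim
                · rcases le_total y (91 / 400) with h30 | h30
                  · exact (not_lt_of_box h 7 (-1) h23 hx1 h29 h30 (by norm_num [max_def])
                      (by norm_num [max_def])).elim
                  · rcases le_total y (47 / 200) with h31 | h31
                    · exact .inr (near_of_box h23 hx1 h30 h31 (by norm_num [max_def]))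
                    · exact (not_lt_of_box h 2 1 h23 hx1 h31 hy1 (by norm_num [max_def])
                        (by norm_num [max_def])).elim

/-- The second minimum. -/
noncomputable def mu : ℝ := (165 - 15 * √69) / 46

theorem mu_gt : (0.878 : ℝ) < mu := by
  have := sqrt_lt
  rw [mu]; linarith

theorem mu_lt : mu < (0.8783 : ℝ) := by
  have := sqrt_gt
  rw [mu]; linarith

theorem not_far_of_dist_lt {ξ : KR} (h : mu ≤ eMin ξ) {m n : ℤ} (h' : dist ξ m n < mu) : False :=
  (h.trans (eMin_le ξ m n)).not_gt h'

/-- A bilinear function on a rectangle is bounded by its values at the corners. -/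
theorem abs_mul_lt_of_corners {a b u v u0 u1 v0 v1 c : ℝ} (hu0 : u0 ≤ u) (hu1 : u ≤ u1)
    (hv0 : v0 ≤ v) (hv1 : v ≤ v1) (h00 : |(a + u0) * (b + v0)| < c)
    (h01 : |(a + u0) * (b + v1)| < c) (h10 : |(a + u1) * (b + v0)| < c)
    (h11 : |(a + u1) * (b + v1)| < c) : |(a + u) * (b + v)| < c := by
  have hv (w : ℝ) (h0 : |w * (b + v0)| < c) (h1 : |w * (b + v1)| < c) : |w * (b + v)| < c := by
    rw [abs_lt] at *
    constructor <;> rcases le_total 0 w with hw | hw <;> nlinarith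
  have h0 := hv _ h00 h01
  have h1 := hv _ h10 h11
  rw [abs_lt] at *
  constructor <;> rcases le_total 0 (b + v) with hw | hw <;> nlinarith

/-! ### Points with a large Euclidean minimum -/

theorem dist_pt_lt {d d' d0 d1 t : ℝ} (m n : ℤ) (hd0 : d0 ≤ d) (hd1 : d ≤ d1) (ht : |d'| ≤ t)
    (h : ∀ u ∈ ({d0, d1} : Set ℝ), ∀ v ∈ ({-t, t} : Set ℝ), |(4 / 23 * √69 -
      (m + n * ((1 + √69) / 2)) + u) * (-(4 / 23 * √69) - (m + n * ((1 - √69) / 2)) + v)| < 0.878) :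
    dist (pt d d') m n < mu := by
  refine lt_trans ?_ mu_gt
  rw [dist_pt, add_sub_right_comm, add_sub_right_comm]
  exact abs_mul_lt_of_corners hd0 hd1 (abs_le.1 ht).1 (abs_le.1 ht).2
    (h _ (by simp) _ (by simp)) (h _ (by simp) _ (by simp)) (h _ (by simp) _ (by simp))
    (h _ (by simp) _ (by simp))

theorem eMin_pt_pow (n : ℕ) (d d' : ℝ) :
    eMin (pt (eps ^ n * d) (eps⁻¹ ^ n * d')) = eMin (pt d d') :=
  eMin_of_orbitMod (pt_zpow_mem_orbitMod n d d')

theorem eMin_pt_step (d d' : ℝ) : eMin (pt (eps * d) (eps⁻¹ * d')) = eMin (pt d d') := by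
  simpa using eMin_pt_pow 1 d d'

theorem eMin_pt_swap (d d' : ℝ) : eMin (pt (-d') (-d)) = eMin (pt d d') := by
  rw [← eMin_star (pt d d'), star_pt, eMin_neg]

theorem eMin_pt_one_swap (d d' : ℝ) : eMin (pt (1 - d') (-d)) = eMin (pt (1 + d) d') := by
  rw [eMin_of_congr (congr_pt_sub_one d d'), ← eMin_pt_swap, neg_sub, neg_neg]

/-- The ratio `2.5 / 0.1 = 25` exceeds `ε`, so the powers of `ε` cannot jump over the interval. -/
theorem exists_pow_mul_mem {x : ℝ} (h0 : 0 < x) (h1 : x ≤ 2.5) :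
    ∃ n : ℕ, 0.1 ≤ eps ^ n * x ∧ eps ^ n * x ≤ 2.5 := by
  obtain ⟨n, hn1, hn2⟩ := exists_nat_pow_near ((one_le_div h0).2 h1) one_lt_eps
  refine ⟨n, ?_, (le_div_iff₀ h0).1 hn1⟩
  rw [div_lt_iff₀ h0, pow_succ] at hn2
  have : 0 < eps ^ n * x := mul_pos (pow_pos eps_pos n) h0
  nlinarith [eps_lt]

theorem abs_inv_eps_pow_mul_le (n : ℕ) (d : ℝ) : |eps⁻¹ ^ n * d| ≤ |d| := by
  rw [abs_mul, abs_of_pos (pow_pos inv_eps_pos n)]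
  exact mul_le_of_le_one_left (abs_nonneg d)
    (pow_le_one₀ inv_eps_pos.le (by linarith [inv_eps_lt]))

/-- The integers `-1` and `1` together rule out `-2.5 ≤ d ≤ -0.1`. The norm is bilinear in the
displacements, so corners suffice. -/
theorem lt_of_far {d d' : ℝ} (h : mu ≤ eMin (pt d d')) (hd : -2.5 ≤ d) (hd' : |d'| ≤ 0.045) :
    -0.1 < d := by
  by_contra! hd1
  have hs := sqrt_sq
  have h1 := sqrt_gt
  have h2 := sqrt_lt
  rcases le_total d (-0.66) with hm | hm
  · refine not_far_of_dist_lt h (m := -1) (n := 0) (dist_pt_lt _ _ hd hm hd' ?_)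
    rintro _ (rfl | rfl) _ (rfl | rfl) <;> push_cast <;> rw [abs_lt] <;> constructor <;> linarith
  · refine not_far_of_dist_lt h (m := 1) (n := 0) (dist_pt_lt _ _ hm hd1 hd' ?_)
    rintro _ (rfl | rfl) _ (rfl | rfl) <;> push_cast <;> rw [abs_lt] <;> constructor <;> linarith

/-- A negative `d` would be expanded by some power of `ε` into the range just excluded, while `d'`
only shrinks. -/
theorem nonneg_of_far {d d' : ℝ} (h : mu ≤ eMin (pt d d')) (hd : -2.5 ≤ d) (hd' : |d'| ≤ 0.045) :
    0 ≤ d := by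
  by_contra! hd0
  obtain ⟨n, hn1, hn2⟩ := exists_pow_mul_mem (neg_pos.2 hd0) (by linarith)
  rw [← eMin_pt_pow n] at h
  have := lt_of_far h (by linarith) ((abs_inv_eps_pow_mul_le n d').trans hd')
  linarith

theorem abs_inv_eps_mul_le {d c c' : ℝ} (h : |d| ≤ c) (hc : c * 0.04008 ≤ c') :
    |eps⁻¹ * d| ≤ c' := by
  rw [abs_mul, abs_of_pos inv_eps_pos]
  nlinarith [inv_eps_lt, inv_eps_pos, abs_nonneg d]

theorem nonneg_of_far_near_Q {d d' : ℝ} (h : mu ≤ eMin (pt d d')) (hd : |d| ≤ 0.1)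
    (hd' : |d'| ≤ 0.1) : 0 ≤ d := by
  rw [← eMin_pt_step] at h
  refine nonneg_of_mul_nonneg_right (nonneg_of_far h ?_ ?_) eps_pos
  · nlinarith [(abs_le.1 hd).1, eps_lt, eps_pos]
  · exact abs_inv_eps_mul_le hd' (by norm_num)

/-- After translation by `-1` and one multiplication by `ε`, the contracting displacement `d' - 1`
is small, and the point falls under the case near `Q` with expanding displacement `ε d`. -/
theorem nonneg_of_far_near_P {d d' : ℝ} (h : mu ≤ eMin (pt (1 + d) d')) (hd : |d| ≤ 0.1)
    (hd' : |d'| ≤ 0.1) : 0 ≤ d := by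
  rw [eMin_of_congr (congr_pt_sub_one d d'), ← eMin_pt_step] at h
  refine nonneg_of_mul_nonneg_right (nonneg_of_far h ?_ ?_) eps_pos
  · nlinarith [(abs_le.1 hd).1, eps_lt, eps_pos]
  · refine abs_inv_eps_mul_le (c := 1.1) ?_ (by norm_num)
    rw [abs_le] at *
    constructor <;> linarith

theorem dist_pt_one_add (d d' : ℝ) :
    dist (pt (1 + d) d') 2 1 = |(-(3 / 2 + 15 / 46 * √69) + d) * (15 / 46 * √69 - 5 / 2 + d')| := by
  rw [dist_pt]
  congr 1
  push_cast
  ring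

theorem mu_eq : mu = (3 / 2 + 15 / 46 * √69) * (15 / 46 * √69 - 5 / 2) := by
  rw [mu]
  linear_combination (-(15 / 46) ^ 2) * sqrt_sq

/-- The symmetry of `eMin_pt_one_swap` turns `d ≥ 0` into `d' ≤ 0`. With these signs both factors of
the norm at `(2, 1)` shrink in absolute value, and their product is exactly `mu` at `P 0`. -/
theorem eq_zero_of_far_near_P {d d' : ℝ} (h : mu ≤ eMin (pt (1 + d) d')) (hd : |d| ≤ 0.1)
    (hd' : |d'| ≤ 0.1) : d = 0 ∧ d' = 0 := by
  have h0 := nonneg_of_far_near_P h hd hd'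
  have h0' : 0 ≤ -d' := by
    refine nonneg_of_far_near_P (d' := -d) ?_ (by rwa [abs_neg]) (by rwa [abs_neg])
    rwa [← sub_eq_add_neg, eMin_pt_one_swap]
  have hdist := h.trans (eMin_le _ 2 1)
  have h1 := sqrt_gt
  have h2 := sqrt_lt
  rw [abs_le] at hd hd'
  rw [dist_pt_one_add, mu_eq, abs_of_nonpos (mul_nonpos_of_nonpos_of_nonneg (by linarith)
    (by linarith))] at hdist
  constructor <;> nlinarith

theorem near_one_of_far {d d' : ℝ} (h : mu ≤ eMin (pt d d')) (hd0 : 0.1 ≤ d) (hd1 : d ≤ 2.5)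
    (hd' : |d'| ≤ 0.0045) : |d - 1| ≤ 0.1 := by
  have hs := sqrt_sq
  have h1 := sqrt_gt
  have h2 := sqrt_lt
  by_contra! hc
  rcases lt_abs.1 hc with hc | hc
  · rcases le_total d 1.415 with hm | hm
    · refine not_far_of_dist_lt h (m := -2) (n := 1)
        (dist_pt_lt _ _ (d0 := 1.1) (by linarith) hm hd' ?_)
      rintro _ (rfl | rfl) _ (rfl | rfl) <;> push_cast <;> rw [abs_lt] <;> constructor <;> linarith
    · refine not_far_of_dist_lt h (m := 2) (n := 1) (dist_pt_lt _ _ hm hd1 hd' ?_)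
      rintro _ (rfl | rfl) _ (rfl | rfl) <;> push_cast <;> rw [abs_lt] <;> constructor <;> linarith
  · rcases le_total d 0.37 with hm | hm
    · refine not_far_of_dist_lt h (m := -3) (n := 1) (dist_pt_lt _ _ hd0 hm hd' ?_)
      rintro _ (rfl | rfl) _ (rfl | rfl) <;> push_cast <;> rw [abs_lt] <;> constructor <;> linarith
    rcases le_total d 0.8085 with hm' | hm'
    · refine not_far_of_dist_lt h (m := 2) (n := 0) (dist_pt_lt _ _ hm hm' hd' ?_)
      rintro _ (rfl | rfl) _ (rfl | rfl) <;> push_cast <;> rw [abs_lt] <;> constructor <;> linarith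
    · refine not_far_of_dist_lt h (m := -7) (n := 2)
        (dist_pt_lt _ _ (d1 := 0.9) hm' (by linarith) hd' ?_)
      rintro _ (rfl | rfl) _ (rfl | rfl) <;> push_cast <;> rw [abs_lt] <;> constructor <;> linarith

theorem mem_orbit_of_far_near_Q {d d' : ℝ} (h : mu ≤ eMin (pt d d')) (hd : 0 < d) (hd1 : d ≤ 0.1)
    (hd' : |d'| ≤ 0.1) : pt d d' ∈ orbitMod (P 0) := by
  -- The preliminary factor `ε` brings `|d'|` from 0.1 below the 0.0045 required by
  -- `near_one_of_far`.
  obtain ⟨n, hn1, hn2⟩ := exists_pow_mul_mem (mul_pos eps_pos hd) (by nlinarith [eps_lt])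
  have h' := h
  rw [← eMin_pt_step, ← eMin_pt_pow n] at h'
  have hsmall : |eps⁻¹ ^ n * (eps⁻¹ * d')| ≤ 0.0045 :=
    (abs_inv_eps_pow_mul_le _ _).trans (abs_inv_eps_mul_le hd' (by norm_num))
  have hnear := near_one_of_far h' hn1 hn2 hsmall
  rw [← add_sub_cancel 1 (eps ^ n * (eps * d))] at h'
  obtain ⟨h1, h2⟩ := eq_zero_of_far_near_P h' hnear (hsmall.trans (by norm_num))
  have := orbitMod_symm (pt_zpow_mem_orbitMod (n + 1 : ℕ) d d')
  rw [zpow_natCast, zpow_natCast, pow_succ, pow_succ, mul_assoc, mul_assoc, h2, sub_eq_zero.1 h1,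
    pt_one] at this
  exact this

/-- The points congruent to a unit multiple of `Q` or of `P 0`. -/
def IsExtremal (ξ : KR) : Prop := ξ ∈ orbitMod Q ∨ ξ ∈ orbitMod (P 0)

theorem IsExtremal.of_orbitMod {ξ η : KR} (h : IsExtremal η) (h' : ξ ∈ orbitMod η) :
    IsExtremal ξ :=
  h.imp (orbitMod_trans h') (orbitMod_trans h')

theorem star_Q : star Q = -Q := by
  ext <;> simp [Q]

theorem star_P_zero_mem : star (P 0) ∈ orbitMod (P 0) := by
  rw [← pt_one, star_pt]
  refine orbitMod_trans (neg_mem_orbitMod _) (orbitMod_of_congr ?_)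
  simpa using (congr_pt_sub_one 0 0).symm

theorem IsExtremal.star {ξ : KR} (h : IsExtremal ξ) : IsExtremal (star ξ) := by
  refine h.imp (fun h => ?_) (fun h => ?_)
  · exact orbitMod_trans (star_mem_orbitMod h) (star_Q ▸ neg_mem_orbitMod Q)
  · exact orbitMod_trans (star_mem_orbitMod h) star_P_zero_mem

theorem IsExtremal.neg {ξ : KR} (h : IsExtremal ξ) : IsExtremal (-ξ) :=
  h.of_orbitMod (neg_mem_orbitMod ξ)

theorem isExtremal_of_far_near_Q {d d' : ℝ} (h : mu ≤ eMin (pt d d')) (hd : |d| ≤ 0.1)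
    (hd' : |d'| ≤ 0.1) : IsExtremal (pt d d') := by
  rcases (nonneg_of_far_near_Q h hd hd').lt_or_eq with h0 | rfl
  · exact .inr (mem_orbit_of_far_near_Q h h0 (abs_le.1 hd).2 hd')
  -- With no expanding displacement, conjugation and sign exchange the two directions and the same
  -- argument applies to `-d'`.
  · have h' := h
    rw [← eMin_pt_swap] at h'
    rw [← abs_neg] at hd hd'
    rcases (nonneg_of_far_near_Q h' hd' hd).lt_or_eq with h0 | h0
    · have := (IsExtremal.star (.inr (mem_orbit_of_far_near_Q h' h0 (abs_le.1 hd').2 hd))).neg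
      rwa [star_pt, neg_neg, neg_neg, neg_neg] at this
    · rw [neg_eq_zero.1 h0.symm, pt_zero]
      exact .inl (mem_orbitMod_self Q)

theorem eq_pt (ξ : KR) : ξ = pt (phi ξ - 4 / 23 * √69) (psi ξ + 4 / 23 * √69) := by
  refine ext_phi_psi ?_ ?_
  · rw [phi_pt]; ring
  · rw [psi_pt]; ring

theorem dist_mk (x y : ℝ) (m n : ℤ) :
    dist ⟨x, y⟩ m n = |(x - (m + n / 2)) ^ 2 - 69 * (y - n / 2) ^ 2| := by
  rw [dist, ← norm_eq, QuadraticAlgebra.norm_def, lat]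
  congr 1
  simp
  ring

theorem isExtremal_of_far_of_mem {x y : ℝ} (h : mu ≤ eMin ⟨x, y⟩) (hx0 : 0 ≤ x) (hx1 : x ≤ 1 / 2)
    (hy0 : 0 ≤ y) (hy1 : y ≤ 1 / 4) : IsExtremal ⟨x, y⟩ := by
  have h1 := sqrt_gt
  have h2 := sqrt_lt
  have hbound (w c e : ℝ) (hw : |c| + 8.307 * |w| ≤ e) : |c| + |√69 * w| ≤ e := by
    rw [abs_mul, abs_of_pos (by linarith : 0 < √(69 : ℝ))]
    nlinarith [abs_nonneg w]
  have hfar (m n : ℤ) : 0.878 < |(x - (m + n / 2)) ^ 2 - 69 * (y - n / 2) ^ 2| := by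
    rw [← dist_mk]
    exact mu_gt.trans_le (h.trans (eMin_le _ m n))
  rw [eq_pt ⟨x, y⟩, phi_apply, psi_apply] at h ⊢
  rcases near_Q_or_P hfar hx0 hx1 hy0 hy1 with hn | hn
  · have hb := hbound _ _ _ hn
    refine isExtremal_of_far_near_Q h ?_ ?_
    · rw [show x + √69 * y - 4 / 23 * √69 = (x - 0) + √69 * (y - 4 / 23) by ring]
      exact (abs_add_le _ _).trans (by linarith)
    · rw [show x - √69 * y + 4 / 23 * √69 = (x - 0) - √69 * (y - 4 / 23) by ring]
      exact (abs_sub _ _).trans (by linarith)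
  · have hb := hbound _ _ _ hn
    rw [← add_sub_cancel 1 (x + √69 * y - 4 / 23 * √69)] at h ⊢
    have hd : |x + √69 * y - 4 / 23 * √69 - 1| ≤ 0.1 := by
      have := (abs_add_le (x - 1 / 2) (√69 * (y - 0.2341))).trans hb
      rw [abs_le] at this ⊢
      constructor <;> linarith
    have hd' : |x - √69 * y + 4 / 23 * √69| ≤ 0.1 := by
      have := (abs_sub (x - 1 / 2) (√69 * (y - 0.2341))).trans hb
      rw [abs_le] at this ⊢
      constructor <;> linarith
    obtain ⟨e1, e2⟩ := eq_zero_of_far_near_P h hd hd'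
    rw [e1, e2, add_zero, pt_one]
    exact .inr (mem_orbitMod_self _)

/-- Rounding moves the point into `|x| ≤ 1/2`, `|y| ≤ 1/4`; sign and conjugation then reduce to the
quarter that was covered. -/
theorem isExtremal_of_far {ξ : KR} (h : mu ≤ eMin ξ) : IsExtremal ξ := by
  set n := round (2 * ξ.im) with hn
  set m := round (ξ.re - n / 2) with hm
  have hy := abs_sub_round (2 * ξ.im)
  have hx := abs_sub_round (ξ.re - n / 2)
  rw [← hn] at hy
  rw [← hm] at hx
  have hc : Congr (ξ - lat m n) ξ := congr_iff.2 ⟨-m, -n, by ext <;> simp [lat] <;> ring⟩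
  refine IsExtremal.of_orbitMod ?_ (orbitMod_of_congr hc.symm)
  rw [← eMin_of_congr hc] at h
  have hre : (ξ - lat m n).re = ξ.re - n / 2 - m := by simp [lat]; ring
  have him : 2 * (ξ - lat m n).im = 2 * ξ.im - n := by simp [lat]; ring
  rw [← hre] at hx
  rw [← him] at hy
  generalize ξ - lat m n = η at h hx hy
  rw [abs_le] at hx hy
  rcases le_total 0 η.re with h1 | h1 <;> rcases le_total 0 η.im with h2 | h2
  · exact isExtremal_of_far_of_mem h h1 (by linarith) h2 (by linarith)
  · rw [← eMin_star] at h
    have e : star η = ⟨η.re, -η.im⟩ := by ext <;> simp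
    rw [e] at h
    have := isExtremal_of_far_of_mem h h1 (by linarith) (by linarith) (by linarith)
    rw [← e] at this
    simpa using this.star
  · rw [← eMin_star, ← eMin_neg] at h
    have e : -star η = ⟨-η.re, η.im⟩ := by ext <;> simp
    rw [e] at h
    have := isExtremal_of_far_of_mem h (by linarith) (by linarith) (by linarith) (by linarith)
    rw [← e] at this
    simpa using this.neg.star
  · rw [← eMin_neg] at h
    have := isExtremal_of_far_of_mem (x := -η.re) (y := -η.im) h (by linarith) (by linarith)
      (by linarith) (by linarith)
    simpa using IsExtremal.neg this

/-! ### Lower bounds for Euclidean minima -/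

theorem le_dist_Q (m n : ℤ) : 25 / 23 ≤ dist Q m n := by
  obtain ⟨T, hT⟩ : ∃ T, T = m ^ 2 + m * n - 17 * n ^ 2 + 12 * n := ⟨_, rfl⟩
  have h : dist Q m n = |(T : ℝ) - 48 / 23| := by
    rw [Q, dist_mk, hT]
    congr 1
    push_cast
    ring
  obtain ⟨a, ha⟩ : ∃ a, m = 3 * a ∨ m = 3 * a + 1 ∨ m = 3 * a + 2 := ⟨m / 3, by omega⟩
  obtain ⟨b, hb⟩ : ∃ b, n = 3 * b ∨ n = 3 * b + 1 ∨ n = 3 * b + 2 := ⟨n / 3, by omega⟩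
  -- Modulo 3, `T` is `(m - n)²`, which is never 2. If `T = 3`, then `m = n + 3c`, and modulo 9 `T`
  -- becomes `3n(n + 1)`, which is never 3. The nearest remaining value to `48/23` is `T = 1`.
  have h2 : T ≠ 2 := by
    rintro rfl
    rcases ha with rfl | rfl | rfl <;> rcases hb with rfl | rfl | rfl <;> ring_nf at hT <;> omega
  have h3 : T ≠ 3 := by
    rintro rfl
    have h1 : (m - n) % 3 = 0 := by
      rcases ha with rfl | rfl | rfl <;> rcases hb with rfl | rfl | rfl <;> ring_nf at hT ⊢ <;>
        omega
    obtain ⟨c, hc⟩ : ∃ c, m = n + 3 * c := ⟨(m - n) / 3, by omega⟩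
    subst hc
    rcases hb with rfl | rfl | rfl <;> ring_nf at hT <;> omega
  rw [h, le_abs]
  rcases (by omega : T ≤ 1 ∨ 4 ≤ T) with h | h
  · right
    have : (T : ℝ) ≤ 1 := by exact_mod_cast h
    linarith
  · left
    have : (4 : ℝ) ≤ T := by exact_mod_cast h
    linarith

theorem eMin_Q : eMin Q = 25 / 23 := by
  refine le_antisymm ((eMin_le Q 1 0).trans_eq ?_) (le_eMin le_dist_Q)
  rw [Q, dist_mk, abs_of_nonpos] <;> norm_num

/-- Multiplication by a power of the fundamental unit balances two reals of small product. -/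
theorem exists_zpow_balanced {u v : ℝ} (h : |u * v| < 0.8783) :
    ∃ j : ℤ, |eps ^ j * u| ≤ 4.69 ∧ |eps⁻¹ ^ j * v| ≤ 4.69 := by
  have key {x y : ℝ} (hx : x ≠ 0) (h : |x * y| < 0.8783) :
      ∃ j : ℤ, |eps ^ j * x| ≤ 4.69 ∧ |eps⁻¹ ^ j * y| ≤ 4.69 := by
    -- The power is chosen so that `|ε^j x|` lies within a factor `ε` below 4.69; the other factor
    -- is then at most `0.8783 ε / 4.69`, which is again below 4.69.
    obtain ⟨n, hn1, hn2⟩ := exists_mem_Ico_zpow (x := |x| / 4.69)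
      (div_pos (abs_pos.2 hx) (by norm_num)) one_lt_eps
    have hp : 0 < eps ^ n := zpow_pos eps_pos n
    have hp' : 0 < eps ^ (n + 1) := zpow_pos eps_pos _
    refine ⟨-(n + 1), ?_, ?_⟩
    · rw [abs_mul, zpow_neg, abs_of_pos (inv_pos.2 hp'), inv_mul_le_iff₀ hp']
      rw [div_lt_iff₀ (by norm_num)] at hn2
      exact hn2.le
    · rw [abs_mul, inv_zpow', neg_neg, abs_of_pos hp', zpow_add_one₀ eps_pos.ne']
      rw [le_div_iff₀ (by norm_num)] at hn1
      rw [abs_mul] at h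
      have h1 : eps ^ n * 4.69 * |y| ≤ 0.8783 :=
        (mul_le_mul_of_nonneg_right hn1 (abs_nonneg y)).trans h.le
      have h2 : 0 ≤ eps ^ n * |y| := mul_nonneg hp.le (abs_nonneg y)
      nlinarith [eps_lt]
  by_cases hu : u = 0
  · by_cases hv : v = 0
    · exact ⟨0, by rw [hu, hv]; norm_num⟩
    · obtain ⟨j, h1, h2⟩ := key hv (by rwa [mul_comm])
      exact ⟨-j, by rwa [← inv_zpow'], by rwa [inv_zpow', neg_neg]⟩
  · exact key hu h

theorem lat_sub (m n a b : ℤ) : lat m n - lat a b = lat (m - a) (n - b) := by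
  ext <;> simp [lat] <;> ring

/-- To bound `eMin ξ` from below, it is enough to consider balanced differences. -/
theorem le_eMin_of_balanced {ξ : KR} {c : ℝ} (hc : c ≤ mu)
    (h : ∀ j : ℤ, ∃ η, Congr (embInt (unitE ^ j : (𝓞 K)ˣ) * ξ) η ∧ ∀ m n : ℤ,
      |phi (η - lat m n)| ≤ 4.69 → |psi (η - lat m n)| ≤ 4.69 → c ≤ dist η m n) :
    c ≤ eMin ξ := by
  refine le_eMin fun m n => ?_
  by_contra! hlt
  obtain ⟨j, h1, h2⟩ := exists_zpow_balanced (lt_trans (lt_of_lt_of_le hlt hc) mu_lt)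
  obtain ⟨η, hη, hb⟩ := h j
  obtain ⟨a, b, hab⟩ := congr_iff.1 hη
  obtain ⟨m', n', hmn⟩ := exists_lat ((unitE ^ j : (𝓞 K)ˣ) * latO m n)
  rw [embInt_mul, embInt_latO] at hmn
  have e : η - lat (m' - a) (n' - b) = embInt (unitE ^ j : (𝓞 K)ˣ) * (ξ - lat m n) := by
    rw [mul_sub, hmn, ← lat_sub, ← hab]
    ring
  have hphi := congrArg phi e
  have hpsi := congrArg psi e
  rw [map_mul, phi_unitE_zpow] at hphi
  rw [map_mul, psi_unitE_zpow] at hpsi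
  have := hb (m' - a) (n' - b) (by rwa [hphi]) (by rwa [hpsi])
  rw [dist, hphi, hpsi, mul_mul_mul_comm, ← mul_zpow, mul_inv_cancel₀ eps_pos.ne', one_zpow,
    one_mul] at this
  exact this.not_gt hlt

/-- The change of `|N(ξ - α)|` under a small displacement of `ξ`. -/
theorem le_dist_pt_add {d d' e e' c δ : ℝ} {m n : ℤ} (h : c ≤ dist (pt d d') m n)
    (h1 : |phi (pt (d + e) (d' + e') - lat m n)| ≤ 4.69)
    (h2 : |psi (pt (d + e) (d' + e') - lat m n)| ≤ 4.69) (hδ : |e| + |e'| ≤ δ) (hδ' : δ ≤ 0.1) :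
    c - 4.79 * δ ≤ dist (pt (d + e) (d' + e')) m n := by
  have e1 : phi (pt d d' - lat m n) = phi (pt (d + e) (d' + e') - lat m n) - e := by
    rw [map_sub, map_sub, phi_pt, phi_pt]; ring
  have e2 : psi (pt d d' - lat m n) = psi (pt (d + e) (d' + e') - lat m n) - e' := by
    rw [map_sub, map_sub, psi_pt, psi_pt]; ring
  rw [dist, e1, e2] at h
  rw [dist]
  generalize phi (pt (d + e) (d' + e') - lat m n) = u at h h1
  generalize psi (pt (d + e) (d' + e') - lat m n) = v at h h2
  -- The factor 4.79 is 4.69 from the linear terms plus 0.1 from `e e'`.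
  have h3 : |(u - e) * (v - e')| ≤ |u * v| + |e * v| + |e' * u| + |e * e'| := by
    rw [show (u - e) * (v - e') = u * v + -(e * v) + -(e' * u) + e * e' by ring]
    refine (abs_add_le _ _).trans (add_le_add_left ((abs_add_le _ _).trans ?_) _)
    rw [abs_neg]
    refine add_le_add_left ((abs_add_le _ _).trans ?_) _
    rw [abs_neg]
  rw [abs_mul e, abs_mul e', abs_mul e] at h3
  have := abs_nonneg e
  have := abs_nonneg e'
  nlinarith [mul_le_mul_of_nonneg_left h2 (abs_nonneg e),
    mul_le_mul_of_nonneg_left h1 (abs_nonneg e')]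

/-- The gap between `25/23` and `mu` exceeds `4.79 * 0.042`. -/
theorem le_dist_near_Q {d d' : ℝ} {m n : ℤ} (h1 : |phi (pt d d' - lat m n)| ≤ 4.69)
    (h2 : |psi (pt d d' - lat m n)| ≤ 4.69) (hd : |d| + |d'| ≤ 0.042) :
    mu ≤ dist (pt d d') m n := by
  have := le_dist_Q m n
  rw [← pt_zero] at this
  have := le_dist_pt_add (e := d) (e' := d') this (by rwa [zero_add, zero_add])
    (by rwa [zero_add, zero_add]) hd (by norm_num)
  rw [zero_add, zero_add] at this
  linarith [mu_lt]

theorem le_dist_P_zero {m n : ℤ} (h1 : |phi (pt 1 0 - lat m n)| ≤ 4.69)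
    (h2 : |psi (pt 1 0 - lat m n)| ≤ 4.69) : mu ≤ dist (pt 1 0) m n := by
  have hs := sqrt_sq
  have hs1 := sqrt_gt
  have hs2 := sqrt_lt
  rw [dist_pt, le_abs]
  rw [map_sub, phi_pt, phi_lat, abs_le] at h1
  rw [map_sub, psi_pt, psi_lat, abs_le] at h2
  -- Subtracting the two bounds isolates `n√69` and leaves `n = 0, 1`; then `m` has finitely many
  -- values.
  have hn0 : 0 ≤ n := by
    by_contra hn
    have : (n : ℝ) ≤ -1 := by exact_mod_cast (by omega : n ≤ -1)
    nlinarith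
  have hn1 : n < 2 := by
    by_contra hn
    have : (2 : ℝ) ≤ n := by exact_mod_cast (by omega : 2 ≤ n)
    nlinarith
  have hm0 : -3 < m := by
    have : (-3 : ℝ) < m := by interval_cases n <;> push_cast at * <;> linarith
    exact_mod_cast this
  have hm1 : m < 4 := by
    have : (m : ℝ) < 4 := by interval_cases n <;> push_cast at * <;> linarith
    exact_mod_cast this
  rw [mu]
  interval_cases n <;> interval_cases m <;> push_cast at * <;>
    first | exact .inl (by linarith) | exact .inr (by linarith)

theorem congr_pt_sub_zpow (j : ℤ) (d d' : ℝ) :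
    Congr (pt (eps ^ j + d) d') (pt d (d' - eps⁻¹ ^ j)) := by
  refine ⟨(unitE ^ j : (𝓞 K)ˣ), ext_phi_psi ?_ ?_⟩
  · rw [map_sub, phi_pt, phi_pt, phi_unitE_zpow]; ring
  · rw [map_sub, psi_pt, psi_pt, psi_unitE_zpow]; ring

theorem inv_eps_zpow_le {j : ℤ} (h : 0 < j) : |eps⁻¹ ^ j| ≤ 0.042 := by
  rw [abs_of_pos (zpow_pos inv_eps_pos j)]
  lift j to ℕ using h.le
  rw [zpow_natCast]
  refine (pow_le_of_le_one inv_eps_pos.le ?_ (by omega)).trans ?_ <;> linarith [inv_eps_lt]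

/-- For `j < 0` the point `ε^j P 0` is near `Q` outright; for `j > 0` it is so after subtraction of
the integer `ε^j`. Only `j = 0` needs the explicit check. -/
theorem mu_le_eMin_P_zero : mu ≤ eMin (P 0) := by
  rw [← pt_one]
  refine le_eMin_of_balanced le_rfl fun j => ?_
  have h := pt_zpow_mul j 1 0
  rw [mul_one, mul_zero] at h
  rcases lt_trichotomy j 0 with hj | rfl | hj
  · refine ⟨_, h, fun m n h1 h2 => le_dist_near_Q h1 h2 ?_⟩
    rw [abs_zero, add_zero, ← neg_neg j, ← inv_zpow']
    exact inv_eps_zpow_le (neg_pos.2 hj)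
  · refine ⟨_, h, fun m n h1 h2 => ?_⟩
    rw [zpow_zero] at *
    exact le_dist_P_zero h1 h2
  · have h' := congr_pt_sub_zpow j 0 0
    rw [add_zero, zero_sub] at h'
    refine ⟨_, h.trans h', fun m n h1 h2 => le_dist_near_Q h1 h2 ?_⟩
    rw [abs_zero, zero_add, abs_neg]
    exact inv_eps_zpow_le hj

theorem eMin_P_zero : eMin (P 0) = mu := by
  refine le_antisymm ((eMin_le _ 2 1).trans_eq ?_) mu_le_eMin_P_zero
  have h1 := sqrt_gt
  have h2 := dist_pt_one_add 0 0
  rw [add_zero, pt_one] at h2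
  rw [h2, mu_eq, abs_of_nonpos (mul_nonpos_of_nonpos_of_nonneg (by linarith) (by linarith))]
  ring

/-! ### Rational points approximating `P 0` -/

theorem congr_zpow_mul {u : (𝓞 K)ˣ} {ξ : KR} (h : Congr (embInt (u : 𝓞 K) * ξ) ξ) (k : ℤ) :
    Congr (embInt ((u ^ k : (𝓞 K)ˣ) : 𝓞 K) * ξ) ξ := by
  induction k with
  | zero => simpa [embInt_one] using Congr.refl _
  | succ k ih =>
    have := (ih.mul u).trans h
    rwa [← mul_assoc, ← embInt_mul, ← Units.val_mul, ← zpow_one_add, add_comm] at this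
  | pred k ih =>
    have h1 := (ih.trans h.symm).mul (u⁻¹ : (𝓞 K)ˣ)
    rwa [← mul_assoc, ← embInt_mul, ← Units.val_mul, ← mul_assoc (embInt _), ← embInt_mul,
      ← Units.val_mul, inv_mul_cancel, Units.val_one, embInt_one, one_mul, ← zpow_neg_one u,
      ← zpow_add, neg_add_eq_sub] at h1

/-- The displacement from `P 0` of a point of period `n` under multiplication by `ε`. -/
noncomputable def gap (n : ℕ) : ℝ := eps⁻¹ ^ n / (1 - eps⁻¹ ^ n)

theorem inv_eps_pow_lt {n : ℕ} (hn : 3 ≤ n) : eps⁻¹ ^ n < 0.0001 := by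
  refine (pow_le_pow_of_le_one inv_eps_pos.le (by linarith [inv_eps_lt]) hn).trans_lt ?_
  refine (pow_le_pow_left₀ inv_eps_pos.le inv_eps_lt.le 3).trans_lt (by norm_num)

theorem gap_pos {n : ℕ} (hn : 3 ≤ n) : 0 < gap n :=
  div_pos (pow_pos inv_eps_pos n) (by linarith [inv_eps_pow_lt hn])

theorem gap_le {n : ℕ} (hn : 3 ≤ n) : gap n ≤ 2 * eps⁻¹ ^ n := by
  have h := inv_eps_pow_lt hn
  have h' := pow_pos inv_eps_pos n
  rw [gap, div_le_iff₀ (by linarith)]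
  nlinarith

theorem one_add_gap_mul {n : ℕ} (hn : 3 ≤ n) : eps⁻¹ ^ n * (1 + gap n) = gap n := by
  have h := inv_eps_pow_lt hn
  have : 1 - eps⁻¹ ^ n ≠ 0 := by linarith
  rw [gap]
  generalize eps⁻¹ ^ n = x at this
  field_simp
  ring

theorem pt_gap_periodic {n : ℕ} (hn : 3 ≤ n) :
    Congr (embInt ((unitE ^ (n : ℤ) : (𝓞 K)ˣ) : 𝓞 K) * pt (1 + gap n) (-gap n))
      (pt (1 + gap n) (-gap n)) := by
  have h := one_add_gap_mul hn
  have h0 : eps ^ n * eps⁻¹ ^ n = 1 := by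
    rw [← mul_pow, mul_inv_cancel₀ eps_pos.ne', one_pow]
  refine (pt_zpow_mul n _ _).trans ?_
  convert congr_pt_sub_zpow n (1 + gap n) (eps⁻¹ ^ (n : ℤ) * -gap n) using 2
  · rw [zpow_natCast]
    linear_combination (-eps ^ n) * h + (1 + gap n) * h0
  · rw [zpow_natCast]
    linear_combination h

/-- By periodicity only the `n` points of the cycle matter. One is within `gap n` of `P 0` in each
valuation, losing at most `4.79 * 2 * gap n`; the others are near `Q`. -/
theorem le_eMin_pt_gap {n : ℕ} (hn : 3 ≤ n) :
    mu - 10 * gap n ≤ eMin (pt (1 + gap n) (-gap n)) := by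
  have hg := gap_pos hn
  have hg1 := gap_le hn
  have hr := inv_eps_pow_lt hn
  refine le_eMin_of_balanced (by linarith) fun j => ?_
  obtain ⟨i, k, hi, rfl⟩ : ∃ (i : ℕ) (k : ℤ), i < n ∧ j = -i + n * k := by
    have h1 := Int.emod_nonneg (-j) (by omega : (n : ℤ) ≠ 0)
    have h2 := Int.emod_lt_of_pos (-j) (by omega : 0 < (n : ℤ))
    refine ⟨(-j % n).toNat, -(-j / n), by omega, ?_⟩
    have := Int.emod_add_mul_ediv (-j) n
    rw [Int.toNat_of_nonneg h1]
    linarith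
  have hper := (congr_zpow_mul (pt_gap_periodic hn) k).mul (unitE ^ (-i : ℤ) : (𝓞 K)ˣ)
  rw [← mul_assoc, ← embInt_mul, ← Units.val_mul, ← zpow_mul, ← zpow_add] at hper
  refine ⟨_, hper.trans (pt_zpow_mul _ _ _), fun m n' h1 h2 => ?_⟩
  rcases Nat.eq_zero_or_pos i with rfl | hi0
  · simp only [Nat.cast_zero, neg_zero, zpow_zero, one_mul] at *
    rw [← zero_add (-gap n)] at h1 h2 ⊢
    have hP := mu_le_eMin_P_zero.trans (eMin_le _ m n')
    rw [← pt_one] at hP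
    have := le_dist_pt_add hP h1 h2 (δ := 2 * gap n)
      (by rw [abs_neg, abs_of_pos hg]; linarith) (by linarith)
    linarith
  · refine le_trans (by linarith) (le_dist_near_Q h1 h2 ?_)
    have hle : eps⁻¹ ≤ 0.04008 := inv_eps_lt.le
    have hsmall (a : ℕ) (ha : 1 ≤ a) : eps⁻¹ ^ a ≤ 0.04008 :=
      (pow_le_of_le_one inv_eps_pos.le (by linarith) (by omega)).trans hle
    have hsmall' (a : ℕ) (ha : 2 ≤ a) : eps⁻¹ ^ a ≤ 0.0017 :=
      (pow_le_pow_of_le_one inv_eps_pos.le (by linarith) ha).trans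
        ((pow_le_pow_left₀ inv_eps_pos.le hle 2).trans (by norm_num))
    -- Since `n ≥ 3`, the exponents `i` and `n - i` are not both 1.
    have hsum : eps⁻¹ ^ i + eps⁻¹ ^ (n - i) ≤ 0.04178 := by
      rcases (by omega : 2 ≤ i ∨ 2 ≤ n - i) with h | h
      · linarith [hsmall' i h, hsmall (n - i) (by omega)]
      · linarith [hsmall i hi0, hsmall' (n - i) h]
    have e1 : eps ^ (-i : ℤ) = eps⁻¹ ^ i := by rw [← inv_zpow', zpow_natCast]
    have e2 : eps⁻¹ ^ (-i : ℤ) * gap n = eps⁻¹ ^ (n - i) * (1 + gap n) := by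
      rw [← one_add_gap_mul hn, ← mul_assoc]
      have : eps⁻¹ ^ n = eps⁻¹ ^ i * eps⁻¹ ^ (n - i) := by
        rw [← pow_add, Nat.add_sub_cancel' hi.le]
      rw [this, zpow_neg, zpow_natCast, inv_mul_cancel_left₀ (pow_pos inv_eps_pos i).ne',
        ← this, one_add_gap_mul hn]
    rw [mul_neg, abs_neg, e1, e2, abs_of_pos (mul_pos (pow_pos inv_eps_pos _) (by linarith)),
      abs_of_pos (mul_pos (pow_pos inv_eps_pos _) (by linarith))]
    nlinarith

/-- With `E = ε ^ n`, the periodicity relation says `(E - 1)(ξ - Q) = E`, so `ξ = Q + E / (E - 1)`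
lies in `K`. -/
theorem pt_gap_mem_ratPoints {n : ℕ} (hn : 3 ≤ n) : pt (1 + gap n) (-gap n) ∈ ratPoints := by
  have h := inv_eps_pow_lt hn
  have h0 : eps ^ n * eps⁻¹ ^ n = 1 := by
    rw [← mul_pow, mul_inv_cancel₀ eps_pos.ne', one_pow]
  have h1 : 1 < eps ^ n := one_lt_pow₀ one_lt_eps (by omega)
  let E : K := ((unitE ^ (n : ℤ) : (𝓞 K)ˣ) : 𝓞 K)
  have hE : phi (emb E) = eps ^ n := by
    rw [← zpow_natCast]; exact phi_unitE_zpow n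
  have hE' : psi (emb E) = eps⁻¹ ^ n := by
    rw [← zpow_natCast]; exact psi_unitE_zpow n
  have hgap : gap n * (1 - eps⁻¹ ^ n) = eps⁻¹ ^ n := by
    rw [gap, div_mul_cancel₀ _ (by linarith)]
  have hQ : emb ⟨0, 4 / 23⟩ = Q := by
    rw [emb, Q]
    ext <;> simp
  refine ⟨⟨0, 4 / 23⟩ + E / (E - 1), ext_phi_psi ?_ ?_⟩
  · have := map_div₀ (phi.comp emb) E (E - 1)
    rw [RingHom.comp_apply, RingHom.comp_apply, RingHom.comp_apply, map_sub emb, map_one,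
      map_sub phi, map_one, hE] at this
    rw [map_add, map_add, this, hQ, ← pt_zero, phi_pt, phi_pt, add_zero, add_right_inj,
      div_eq_iff (by linarith)]
    linear_combination (-eps ^ n) * hgap - (1 + gap n) * h0
  · have := map_div₀ (psi.comp emb) E (E - 1)
    rw [RingHom.comp_apply, RingHom.comp_apply, RingHom.comp_apply, map_sub emb, map_one,
      map_sub psi, map_one, hE'] at this
    rw [map_add, map_add, this, hQ, ← pt_zero, psi_pt, psi_pt, add_zero, add_right_inj,
      div_eq_iff (by linarith)]
    linear_combination -hgap

/-- The displacements `gap n` and `-gap n` from `P 0` have the signs for which the norm at `(2, 1)`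
drops below `mu`. -/
theorem eMin_pt_gap_lt {n : ℕ} (hn : 3 ≤ n) : eMin (pt (1 + gap n) (-gap n)) < mu := by
  have h1 := sqrt_gt
  have hg := gap_pos hn
  have hg1 := gap_le hn
  have hr := inv_eps_pow_lt hn
  refine (eMin_le _ 2 1).trans_lt ?_
  rw [dist_pt_one_add, mu_eq, abs_of_nonpos (mul_nonpos_of_nonpos_of_nonneg (by linarith)
    (by linarith))]
  nlinarith

theorem exists_ratPoint_lt_eMin {κ : ℝ} (h : κ < mu) :
    ∃ ξ ∈ ratPoints, κ < eMin ξ ∧ eMin ξ < mu := by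
  -- The loss `10 * gap` is at most `20 ε⁻ⁿ`; passing to `n + 3` meets the condition on the period.
  obtain ⟨n, hn⟩ := exists_pow_lt_of_lt_one (div_pos (sub_pos.2 h) (by norm_num : (0 : ℝ) < 20))
    (by linarith [inv_eps_lt] : eps⁻¹ < 1)
  have h3 : 3 ≤ n + 3 := by omega
  have hle : eps⁻¹ ^ (n + 3) ≤ eps⁻¹ ^ n :=
    pow_le_pow_of_le_one inv_eps_pos.le (by linarith [inv_eps_lt]) (by omega)
  exact ⟨_, pt_gap_mem_ratPoints h3, by linarith [gap_le h3, le_eMin_pt_gap h3],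
    eMin_pt_gap_lt h3⟩

/-! ### The extremal points -/

theorem Q_mem_ratPoints : Q ∈ ratPoints :=
  ⟨⟨0, 4 / 23⟩, by rw [emb, Q]; ext <;> simp⟩

theorem not_congr_Q_neg_Q : ¬ Congr Q (-Q) := by
  intro h
  obtain ⟨m, n, h⟩ := congr_iff.1 h
  have h1 := congrArg QuadraticAlgebra.im h
  simp only [Q, lat, QuadraticAlgebra.im_sub, QuadraticAlgebra.im_neg] at h1
  have h2 : (23 * n : ℝ) = 16 := by linarith
  have h3 : 23 * n = 16 := by exact_mod_cast h2
  omega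

theorem mem_orbitMod_Q_iff {ξ : KR} : ξ ∈ orbitMod Q ↔ Congr ξ Q ∨ Congr ξ (-Q) := by
  constructor
  · rintro ⟨u, hu⟩
    have key (n : ℤ) : Congr (embInt (unitE ^ n : (𝓞 K)ˣ) * Q) Q := by
      simpa [pt_zero] using pt_zpow_mul n 0 0
    obtain ⟨n, rfl | rfl⟩ := exists_zpow_unitE u
    · exact .inl (hu.trans (key n))
    · rw [Units.val_neg, embInt_neg, neg_mul] at hu
      exact .inr (hu.trans (key n).neg)
  · rintro (h | h)
    · exact orbitMod_of_congr h
    · exact orbitMod_trans (orbitMod_of_congr h) (neg_mem_orbitMod Q)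

theorem P_eq_pt (r : ℕ) : P r = pt (eps ^ (-r : ℤ)) 0 := by
  rw [P, pt]
  ext <;> simp <;> ring

theorem P_mem_orbitMod (r : ℕ) : P r ∈ orbitMod (P 0) := by
  have := pt_zpow_mem_orbitMod (-r) 1 0
  rwa [mul_one, mul_zero, ← P_eq_pt, pt_one] at this

theorem mem_orbitMod_P_zero_iff {ξ : KR} : ξ ∈ orbitMod (P 0) ↔ ∃ r : ℕ,
    Congr ξ (P r) ∨ Congr ξ (-P r) ∨ Congr ξ (star (P r)) ∨ Congr ξ (-star (P r)) := by
  constructor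
  · rintro ⟨u, hu⟩
    -- Nonpositive powers of `ε` give `P r`. Nonnegative ones give `pt 0 (-ε⁻ʳ)` after subtraction
    -- of `ε ^ r`, and this is `-star (P r)`.
    have key (n : ℤ) : ∃ r : ℕ, Congr (embInt (unitE ^ n : (𝓞 K)ˣ) * P 0) (P r) ∨
        Congr (embInt (unitE ^ n : (𝓞 K)ˣ) * P 0) (-star (P r)) := by
      have h := pt_zpow_mul n 1 0
      rw [mul_one, mul_zero, pt_one] at h
      obtain ⟨r, rfl | rfl⟩ := n.eq_nat_or_neg
      · refine ⟨r, .inr ?_⟩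
        have h' := congr_pt_sub_zpow r 0 0
        rw [add_zero, zero_sub] at h'
        rw [P_eq_pt r, star_pt, neg_neg, neg_zero, ← inv_zpow']
        exact h.trans h'
      · exact ⟨r, .inl (P_eq_pt r ▸ h)⟩
    obtain ⟨n, rfl | rfl⟩ := exists_zpow_unitE u
    · obtain ⟨r, h | h⟩ := key n
      · exact ⟨r, .inl (hu.trans h)⟩
      · exact ⟨r, .inr (.inr (.inr (hu.trans h)))⟩
    · rw [Units.val_neg, embInt_neg, neg_mul] at hu
      obtain ⟨r, h | h⟩ := key n
      · exact ⟨r, .inr (.inl (hu.trans h.neg))⟩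
      · exact ⟨r, .inr (.inr (.inl (hu.trans (neg_neg (star (P r)) ▸ h.neg))))⟩
  · rintro ⟨r, h | h | h | h⟩ <;> refine orbitMod_trans (orbitMod_of_congr h) ?_
    · exact P_mem_orbitMod r
    · exact orbitMod_trans (neg_mem_orbitMod _) (P_mem_orbitMod r)
    · exact orbitMod_trans (star_mem_orbitMod (P_mem_orbitMod r)) star_P_zero_mem
    · exact orbitMod_trans (neg_mem_orbitMod _)
        (orbitMod_trans (star_mem_orbitMod (P_mem_orbitMod r)) star_P_zero_mem)

theorem P_zero_notMem_ratPoints : P 0 ∉ ratPoints := by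
  rintro ⟨z, hz⟩
  have h1 := congrArg QuadraticAlgebra.im hz
  have h2 : (z.im : ℝ) = 4 / 23 + 1 / (2 * √69) := by
    simpa [emb, P] using h1
  have h3 : √69 = ((138 * (z.im - 4 / 23) : ℚ) : ℝ) := by
    push_cast
    rw [h2]
    have := sqrt_ne_zero
    field_simp
    linear_combination 46 * sqrt_sq
  exact irrational_sqrt ⟨_, h3.symm⟩

/-! ### Computation of the two minima -/

theorem eMin_eq_of_mem_orbitMod_Q {ξ : KR} (h : ξ ∈ orbitMod Q) : eMin ξ = 25 / 23 :=
  (eMin_of_orbitMod h).trans eMin_Q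

theorem eMin_eq_of_mem_orbitMod_P {ξ : KR} (h : ξ ∈ orbitMod (P 0)) : eMin ξ = mu :=
  (eMin_of_orbitMod h).trans eMin_P_zero

theorem eMin_le_of_notMem {ξ : KR} (h : ξ ∉ orbitMod Q) : eMin ξ ≤ mu := by
  by_contra! hc
  exact hc.ne' (eMin_eq_of_mem_orbitMod_P ((isExtremal_of_far hc.le).resolve_left h))

theorem eMin_le_max (ξ : KR) : eMin ξ ≤ 25 / 23 := by
  by_cases h : ξ ∈ orbitMod Q
  · exact (eMin_eq_of_mem_orbitMod_Q h).le
  · linarith [eMin_le_of_notMem h, mu_lt]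

theorem M1_eq {S : Set KR} (hS : Q ∈ S) : M1 S = 25 / 23 :=
  IsGreatest.csSup_eq ⟨⟨Q, hS, eMin_Q⟩, by rintro _ ⟨ξ, -, rfl⟩; exact eMin_le_max ξ⟩

theorem C1_eq {S : Set KR} (hS : Q ∈ S) : C1 S = {ξ ∈ S | ξ ∈ orbitMod Q} := by
  ext ξ
  rw [C1, M1_eq hS]
  refine and_congr_right fun _ => ⟨fun h => ?_, eMin_eq_of_mem_orbitMod_Q⟩
  by_contra hc
  have := eMin_le_of_notMem hc
  linarith [mu_lt]

theorem eMin_le_of_mem_diff {S : Set KR} (hS : Q ∈ S) {ξ : KR} (hξ : ξ ∈ S \ C1 S) :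
    eMin ξ ≤ mu := by
  rw [C1_eq hS] at hξ
  exact eMin_le_of_notMem fun h => hξ.2 ⟨hξ.1, h⟩

theorem mem_diff_of_le {S : Set KR} (hS : Q ∈ S) {ξ : KR} (hξ : ξ ∈ S) (h : eMin ξ ≤ mu) :
    ξ ∈ S \ C1 S := by
  refine ⟨hξ, fun hc => ?_⟩
  rw [C1_eq hS] at hc
  linarith [eMin_eq_of_mem_orbitMod_Q hc.2, mu_lt]

/-- The value is the limit of minima at the periodic points of `K`, so the same argument covers `K`,
where `P 0` is not available, and the whole plane. -/
theorem M2_eq {S : Set KR} (hS : ratPoints ⊆ S) : M2 S = mu := by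
  have hQ := hS Q_mem_ratPoints
  refine csSup_eq_of_forall_le_of_forall_lt_exists_gt ?_ ?_ fun κ hκ => ?_
  · obtain ⟨ξ, hξ, -, h⟩ := exists_ratPoint_lt_eMin (sub_one_lt mu)
    exact ⟨_, ξ, mem_diff_of_le hQ (hS hξ) h.le, rfl⟩
  · rintro _ ⟨ξ, hξ, rfl⟩
    exact eMin_le_of_mem_diff hQ hξ
  · obtain ⟨ξ, hξ, h, h'⟩ := exists_ratPoint_lt_eMin hκ
    exact ⟨_, ⟨ξ, mem_diff_of_le hQ (hS hξ) h'.le, rfl⟩, h⟩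

theorem C2_univ : C2 Set.univ = orbitMod (P 0) := by
  ext ξ
  rw [C2, M2_eq (Set.subset_univ _)]
  refine ⟨fun h => ?_, fun h => ⟨trivial, eMin_eq_of_mem_orbitMod_P h⟩⟩
  refine (isExtremal_of_far h.2.ge).resolve_left fun hQ => ?_
  linarith [eMin_eq_of_mem_orbitMod_Q hQ, h.2, mu_lt]

theorem not_M2Isolated {S : Set KR} (hS : ratPoints ⊆ S) : ¬ M2Isolated S := by
  rintro ⟨κ, hκ, h⟩
  rw [M2_eq hS] at hκ
  obtain ⟨ξ, hξ, h1, h2⟩ := exists_ratPoint_lt_eMin hκ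
  refine h1.not_ge (h ξ ⟨hS hξ, ?_⟩)
  rintro (hc | hc)
  · exact (mem_diff_of_le (hS Q_mem_ratPoints) (hS hξ) h2.le).2 hc
  · exact h2.ne (hc.2.trans (M2_eq hS))

theorem irrational_mu : Irrational mu := by
  rintro ⟨q, hq⟩
  refine irrational_sqrt ⟨(165 - 46 * q) / 15, ?_⟩
  push_cast
  rw [hq, mu]
  ring

end QSqrt69

theorem mainTheorem1 :
    -- `ε` is the fundamental unit
    (∃ e : (𝓞 QSqrt69.K)ˣ,
      ((e : 𝓞 QSqrt69.K) : QSqrt69.K) = QSqrt69.epsK ∧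
        ∀ u : (𝓞 QSqrt69.K)ˣ, ∃ n : ℤ, u = e ^ n ∨ u = -e ^ n) ∧
    -- the first minimum, and where it is attained
    QSqrt69.M1 Set.univ = 25 / 23 ∧
    QSqrt69.M1 QSqrt69.ratPoints = 25 / 23 ∧
    QSqrt69.C1 Set.univ = {ξ | QSqrt69.Congr ξ QSqrt69.Q ∨ QSqrt69.Congr ξ (-QSqrt69.Q)} ∧
    ¬ QSqrt69.Congr QSqrt69.Q (-QSqrt69.Q) ∧
    -- the second minimum, and where it is attained
    QSqrt69.M2 Set.univ = (165 - 15 * Real.sqrt 69) / 46 ∧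
    QSqrt69.M2 QSqrt69.ratPoints = QSqrt69.M2 Set.univ ∧
    Irrational (QSqrt69.M2 Set.univ) ∧
    QSqrt69.C2 Set.univ = {ξ | ∃ r : ℕ,
      QSqrt69.Congr ξ (QSqrt69.P r) ∨ QSqrt69.Congr ξ (-QSqrt69.P r) ∨
      QSqrt69.Congr ξ (star (QSqrt69.P r)) ∨ QSqrt69.Congr ξ (-star (QSqrt69.P r))} ∧
    QSqrt69.C2 Set.univ = QSqrt69.orbitMod (QSqrt69.P 0) ∧
    QSqrt69.P 0 ∉ QSqrt69.ratPoints ∧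
    -- the second minimum is not isolated
    ¬ QSqrt69.M2Isolated Set.univ ∧
    ¬ QSqrt69.M2Isolated QSqrt69.ratPoints := by
  refine ⟨⟨QSqrt69.unitE, QSqrt69.unitE_coe, QSqrt69.exists_zpow_unitE⟩,
    QSqrt69.M1_eq (Set.mem_univ _), QSqrt69.M1_eq QSqrt69.Q_mem_ratPoints, ?_,
    QSqrt69.not_congr_Q_neg_Q, QSqrt69.M2_eq (Set.subset_univ _), ?_, ?_, ?_, QSqrt69.C2_univ,
    QSqrt69.P_zero_notMem_ratPoints, QSqrt69.not_M2Isolated (Set.subset_univ _),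
    QSqrt69.not_M2Isolated subset_rfl⟩
  · ext ξ
    rw [QSqrt69.C1_eq (Set.mem_univ _)]
    exact (and_iff_right (Set.mem_univ ξ)).trans QSqrt69.mem_orbitMod_Q_iff
  · rw [QSqrt69.M2_eq subset_rfl, QSqrt69.M2_eq (Set.subset_univ _)]
  · rw [QSqrt69.M2_eq (Set.subset_univ _)]
    exact QSqrt69.irrational_mu
  · ext ξ
    rw [QSqrt69.C2_univ]
    exact QSqrt69.mem_orbitMod_P_zero_iff
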